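/- Let $k$ be a field and let $X$ be a commutative Hopf $k$-algebra with comultiplication $\Delta$, counit $\varepsilon$ and antipode $S$. A subset $I\subseteq X$ is called a Hopf ideal if $I=f^{-1}(0)$ for some morphism $f\colon X\to Y$ of commutative Hopf $k$-algebras, and a normal Hopf ideal if moreover $f$ can be chosen to be a cokernel (of some morphism $W\to X$) in the category of commutative Hopf $k$-algebras, whose zero morphisms $A\to B$ are the composites $A\xrightarrow{\varepsilon_A}k\to B$ of counit and unit. Let $I$ be a Hopf ideal of $X$. Then the following are equivalent. 1. $I$ is a normal Hopf ideal. 2. $I=XA^+$ for some Hopf subalgebra $A$ of $X$, where $A^+=\ker(\varepsilon|_A\colon A\to k)$ is the augmentation ideal of $A$ and $XA^+$ is the ideal of $X$ generated by $A^+$. 3. For each $x\in I$ we have $x_1S(x_3)\otimes x_2\in X\otimes I$, a subspace of $X\otimes_k X$. Here $x_1\otimes x_2\otimes x_3=(\mathrm{id}\otimes\Delta)\Delta(x)$ in Sweedler's notation. -/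

import Mathlib

open CategoryTheory CategoryTheory.Limits
open scoped TensorProduct

universe u

namespace CommHopfAlgCat

variable {k : Type u} [CommRing k]

/-- The zero morphisms of the pointed category of commutative Hopf `k`-algebras: the zero
morphism `A ⟶ B` is the composite `A ⟶ k ⟶ B` of the counit of `A` and the unit of `B`. -/
noncomputable instance instHasZeroMorphisms : HasZeroMorphisms (CommHopfAlgCat.{u} k) where
  zero A B := ⟨ofHom ((Bialgebra.unitBialgHom k B).comp (Bialgebra.counitBialgHom k A))⟩
  comp_zero {A B} f C := by
    apply hom_ext
    apply BialgHom.ext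
    intro x
    change algebraMap k C (Coalgebra.counit (R := k) (f.hom x)) =
      algebraMap k C (Coalgebra.counit (R := k) x)
    rw [CoalgHomClass.counit_comp_apply]
  zero_comp A {B C} f := by
    apply hom_ext
    apply BialgHom.ext
    intro x
    change f.hom (algebraMap k B (Coalgebra.counit (R := k) x)) =
      algebraMap k C (Coalgebra.counit (R := k) x)
    exact AlgHomClass.commutes f.hom _

theorem zero_apply {A B : CommHopfAlgCat.{u} k} (x : A) :
    (0 : A ⟶ B).hom x = algebraMap k B (Coalgebra.counit (R := k) x) :=
  rfl

/-- The ground ring is a zero object, so the zero morphisms above are those of the pointed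
category. -/
theorem isZero_ground : IsZero (CommHopfAlgCat.of k k : CommHopfAlgCat.{u} k) := by
  refine (IsZero.iff_id_eq_zero _).2 ?_
  apply hom_ext
  apply BialgHom.ext
  intro x
  rfl

end CommHopfAlgCat

namespace CommHopf

variable (k : Type u) [CommRing k] {X : Type u} [CommRing X] [HopfAlgebra k X]

/-- `I` is a Hopf ideal: `I = f⁻¹(0)` for some morphism `f : X ⟶ Y` of commutative Hopf
`k`-algebras. -/
def IsHopfIdeal (I : Ideal X) : Prop :=
  ∃ (Y : CommHopfAlgCat.{u} k) (f : CommHopfAlgCat.of k X ⟶ Y), (I : Set X) = f.hom ⁻¹' {0}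

/-- `I` is a normal Hopf ideal: `I = f⁻¹(0)` for some morphism `f : X ⟶ Y` which is a cokernel
(of some morphism `W ⟶ X`) in the category of commutative Hopf `k`-algebras. -/
def IsNormalHopfIdeal (I : Ideal X) : Prop :=
  ∃ (Y : CommHopfAlgCat.{u} k) (f : CommHopfAlgCat.of k X ⟶ Y),
    Nonempty (NormalEpi f) ∧ (I : Set X) = f.hom ⁻¹' {0}

variable {k}

/-- A subalgebra `A` of `X` is a Hopf subalgebra if `Δ(A) ⊆ A ⊗ A` (as a subspace of `X ⊗ X`)
and `S(A) ⊆ A`. -/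
structure IsHopfSubalgebra (A : Subalgebra k X) : Prop where
  comul_mem : ∀ a ∈ A, Coalgebra.comul (R := k) a ∈
    LinearMap.range (TensorProduct.mapIncl (Subalgebra.toSubmodule A) (Subalgebra.toSubmodule A))
  antipode_mem : ∀ a ∈ A, HopfAlgebra.antipode k a ∈ A

/-- The augmentation ideal `A⁺` of `A`: the kernel of the counit of `X` restricted to `A`. -/
noncomputable def augmentationIdeal (A : Subalgebra k X) : Ideal A :=
  RingHom.ker ((Bialgebra.counitAlgHom k X).comp A.val)

variable (k X) in
/-- The linear map `X ⊗ X ⊗ X → X ⊗ X`, `a ⊗ b ⊗ c ↦ a S(c) ⊗ b`. -/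
noncomputable def mulAntipodeOuter : X ⊗[k] (X ⊗[k] X) →ₗ[k] X ⊗[k] X :=
  (LinearMap.mul' k X ∘ₗ (HopfAlgebra.antipode k).lTensor X).rTensor X ∘ₗ
    (TensorProduct.assoc k X X X).symm.toLinearMap ∘ₗ
    (TensorProduct.comm k X X).toLinearMap.lTensor X

theorem mulAntipodeOuter_tmul (a b c : X) :
    mulAntipodeOuter k X (a ⊗ₜ (b ⊗ₜ c)) = (a * HopfAlgebra.antipode k c) ⊗ₜ b := by
  simp [mulAntipodeOuter]

variable (k X) in
/-- The linear map `X → X ⊗ X`, `x ↦ x₁ S(x₃) ⊗ x₂`. -/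
noncomputable def coadjoint : X →ₗ[k] X ⊗[k] X :=
  mulAntipodeOuter k X ∘ₗ (Coalgebra.comul (R := k) (A := X)).lTensor X ∘ₗ Coalgebra.comul

variable (k) in
/-- The subspace `X ⊗ I` of `X ⊗ X`. -/
noncomputable def tensorIdeal (I : Ideal X) : Submodule k (X ⊗[k] X) :=
  LinearMap.range ((I.restrictScalars k).subtype.lTensor X)

end CommHopf

/-! Read `X` as the functions on an affine group scheme G and `I` as the ideal of a closed subgroup
N. The `R`-points of G are the algebra maps `X → R`, multiplied by convolution, and most identities
are checked on points. Condition 3 says that N is normal, because x₁S(x₃) ⊗ x₂ is the function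
x(gng⁻¹) of (g, n) (`coadjoint_mem_iff_isConjStable`). Conditions 1 and 2 both say that N is the
kernel of a homomorphism out of G: a cokernel of W → X is X modulo the ideal generated by the image
of W⁺, and this ideal depends only on the image of W. Kernels are normal.

The substance is 3 → 2. Let A be the functions invariant under right translation by N
(`coinvariants`). Normality makes A a Hopf subalgebra, and XA⁺ ⊆ I is immediate. Conversely, put x ∈
I into a finite-dimensional subcomodule V, with a basis adapted to V ∩ I. On N the coefficient
matrix is block triangular, so all its maximal minors in the columns of V ∩ I are semi-invariant for
one character c of N. Given a semi-invariant d of inverse weight with ε(d) = 1, multiplication by d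
moves these minors into A. Modulo XA⁺ they become constants, and Cramer's rule kills the
off-diagonal block, hence x.

The crux is d (`exists_isSemiInvariant_inverse`). Each n ↦ c(gng⁻¹) is a character of N, and the
coefficients of this family, as functions of g, form a finite-dimensional subalgebra B of A. Such an
algebra contains s ≠ 0 with sb = ε(b)s, so s(g)c(gng⁻¹) = s(g)c(n). Multiplying s by the antipode of
a translate of c then gives inverse weight, and a further translate normalizes the counit. -/

namespace CommHopf

open WithConv

/-! ### Groups of points, closed subgroups and conjugation -/

section Points

variable {k : Type u} [CommRing k] {X : Type u} [CommRing X] [HopfAlgebra k X]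
  {R S : Type u} [CommRing R] [Algebra k R] [CommRing S] [Algebra k S]

noncomputable instance pointInv : Inv (WithConv (X →ₐ[k] R)) where
  inv g := toConv (g.ofConv.comp (HopfAlgebra.antipodeAlgHom k X))

/-- The `R`-points of a commutative Hopf algebra form a group under convolution. -/
noncomputable instance pointGroup : Group (WithConv (X →ₐ[k] R)) where
  inv_mul_cancel g := by
    apply WithConv.ext
    ext x
    have h := congrArg g.ofConv (HopfAlgebra.mul_antipode_rTensor_comul_apply (R := k) x)
    rw [AlgHom.commutes] at h
    refine (AlgHom.convMul_apply _ g x).trans (Eq.trans ?_ h)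
    generalize Coalgebra.comul (R := k) x = z
    induction z with
    | zero => simp
    | add a b ha hb => rw [map_add, ha, hb, map_add, map_add, map_add]
    | tmul a b =>
      rw [LinearMap.rTensor_tmul, LinearMap.mul'_apply, map_mul]
      rfl

/-- Change of coefficients for the group of `R`-points of a Hopf algebra. -/
noncomputable def mapPoint (h : R →ₐ[k] S) : WithConv (X →ₐ[k] R) →* WithConv (X →ₐ[k] S) where
  toFun g := toConv (h.comp g.ofConv)
  map_one' := by
    apply WithConv.ext
    ext x
    simp [AlgHom.convOne_def, ofConv_toConv, Algebra.ofId_apply]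
  map_mul' f g := WithConv.ext (AlgHom.comp_convMul_distrib h f g)

@[simp]
theorem mapPoint_apply (h : R →ₐ[k] S) (g : WithConv (X →ₐ[k] R)) (x : X) :
    mapPoint h g x = h (g x) := rfl

theorem point_mul_apply (g n : WithConv (X →ₐ[k] R)) (x : X) :
    (g * n) x = Algebra.TensorProduct.lift g.ofConv n.ofConv (fun _ _ => .all _ _)
      (Coalgebra.comul (R := k) x) :=
  AlgHom.convMul_apply g n x

theorem point_inv_apply (g : WithConv (X →ₐ[k] R)) (x : X) :
    g⁻¹ x = g (HopfAlgebra.antipode k x) := rfl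

theorem point_one_apply (x : X) :
    (1 : WithConv (X →ₐ[k] R)) x = algebraMap k R (Coalgebra.counit x) := rfl

/-- The point `n` of `X` lies in the closed subscheme cut out by `I`. -/
def VanishesOn (I : Ideal X) (n : WithConv (X →ₐ[k] R)) : Prop := ∀ x ∈ I, n x = 0

theorem VanishesOn.mapPoint {I : Ideal X} {n : WithConv (X →ₐ[k] R)} (hn : VanishesOn I n)
    (h : R →ₐ[k] S) : VanishesOn I (mapPoint h n) := fun x hx => by
  rw [mapPoint_apply, hn x hx, map_zero]

variable (k) in
/-- The tautological point of the closed subscheme cut out by `I`. -/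
noncomputable def quotientPoint (I : Ideal X) : WithConv (X →ₐ[k] X ⧸ I) :=
  toConv (Ideal.Quotient.mkₐ k I)

@[simp]
theorem quotientPoint_apply (I : Ideal X) (x : X) :
    quotientPoint k I x = Ideal.Quotient.mk I x := rfl

theorem vanishesOn_quotientPoint (I : Ideal X) : VanishesOn I (quotientPoint k I) :=
  fun _ hx => Ideal.Quotient.eq_zero_iff_mem.2 hx

/-- The homomorphism `X ⧸ I → R` defined by a point vanishing on `I`. -/
noncomputable def VanishesOn.lift {I : Ideal X} {n : WithConv (X →ₐ[k] R)} (hn : VanishesOn I n) :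
    X ⧸ I →ₐ[k] R :=
  Ideal.Quotient.liftₐ I n.ofConv hn

theorem VanishesOn.mapPoint_lift {I : Ideal X} {n : WithConv (X →ₐ[k] R)} (hn : VanishesOn I n) :
    CommHopf.mapPoint hn.lift (quotientPoint k I) = n := by
  apply WithConv.ext
  ext x
  rfl

/-- It is enough to test universal points: the two tautological points over (X ⧸ I) ⊗ (X ⧸ I) have
as product Δ followed by the quotient map in both factors. -/
theorem isHopfIdeal_of_vanishesOn {I : Ideal X} (h1 : ∀ x ∈ I, Coalgebra.counit (R := k) x = 0)
    (hmul : ∀ n m : WithConv (X →ₐ[k] (X ⧸ I) ⊗[k] (X ⧸ I)),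
      VanishesOn I n → VanishesOn I m → VanishesOn I (n * m))
    (hinv : ∀ n : WithConv (X →ₐ[k] X ⧸ I), VanishesOn I n → VanishesOn I n⁻¹) :
    I.IsHopfIdeal k where
  counit_eq_zero := h1
  map_mkQ_comul_eq_zero x hx := by
    have := hmul _ _
      ((vanishesOn_quotientPoint (k := k) I).mapPoint Algebra.TensorProduct.includeLeft)
      ((vanishesOn_quotientPoint (k := k) I).mapPoint Algebra.TensorProduct.includeRight) x hx
    rw [point_mul_apply] at this
    change Algebra.TensorProduct.map (Ideal.Quotient.mkₐ k I) (Ideal.Quotient.mkₐ k I)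
      (Coalgebra.comul (R := k) x) = 0
    rw [← this]
    generalize Coalgebra.comul (R := k) x = z
    induction z with
    | zero => simp
    | add a b ha hb => rw [map_add, map_add, ha, hb]
    | tmul a b =>
      change Ideal.Quotient.mk I a ⊗ₜ[k] Ideal.Quotient.mk I b =
        (Ideal.Quotient.mk I a ⊗ₜ[k] 1) * (1 ⊗ₜ[k] Ideal.Quotient.mk I b)
      simp
  antipode_mem x hx := by
    have := hinv _ (vanishesOn_quotientPoint I) x hx
    rw [point_inv_apply, quotientPoint_apply] at this
    exact Ideal.Quotient.eq_zero_iff_mem.1 this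

variable {I : Ideal X}

theorem VanishesOn.mul [I.IsHopfIdeal k] {n m : WithConv (X →ₐ[k] R)} (hn : VanishesOn I n)
    (hm : VanishesOn I m) : VanishesOn I (n * m) := fun x hx => by
  have h : Algebra.TensorProduct.map (Ideal.Quotient.mkₐ k I) (Ideal.Quotient.mkₐ k I)
      (Coalgebra.comul (R := k) x) = 0 :=
    Submodule.IsCoideal.map_mkQ_comul_eq_zero (R := k) (I := I.restrictScalars k) hx
  have h2 := congrArg (Algebra.TensorProduct.lift hn.lift hm.lift (fun _ _ => .all _ _)) h
  rw [map_zero] at h2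
  rw [point_mul_apply, ← h2]
  generalize Coalgebra.comul (R := k) x = z
  induction z with
  | zero => simp
  | add a b ha hb => rw [map_add, ha, hb, map_add, map_add]
  | tmul a b => rfl

theorem VanishesOn.inv [I.IsHopfIdeal k] {n : WithConv (X →ₐ[k] R)} (hn : VanishesOn I n) :
    VanishesOn I n⁻¹ := fun _ hx => hn _ (Ideal.IsHopfIdeal.antipode_mem (R := k) hx)

theorem VanishesOn.one [I.IsHopfIdeal k] : VanishesOn I (1 : WithConv (X →ₐ[k] R)) :=
  fun _ hx => by
    rw [point_one_apply,
      Submodule.IsCoideal.counit_eq_zero (R := k) (I := I.restrictScalars k) hx, map_zero]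

variable (k) in
/-- The closed subscheme cut out by `I` is stable under conjugation. -/
def IsConjStable (I : Ideal X) : Prop :=
  ∀ (R : Type u) [CommRing R] [Algebra k R] (g n : WithConv (X →ₐ[k] R)),
    VanishesOn I n → VanishesOn I (g * n * g⁻¹)

theorem conj_apply (g n : WithConv (X →ₐ[k] R)) (x : X) :
    (g * n * g⁻¹) x = Algebra.TensorProduct.lift g.ofConv n.ofConv (fun _ _ => .all _ _)
      (coadjoint k X x) := by
  rw [mul_assoc, point_mul_apply, coadjoint, LinearMap.comp_apply, LinearMap.comp_apply]
  generalize Coalgebra.comul (R := k) x = z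
  induction z with
  | zero => simp
  | add a b ha hb => rw [map_add, ha, hb, map_add, map_add, map_add]
  | tmul a b =>
    rw [Algebra.TensorProduct.lift_tmul, LinearMap.lTensor_tmul]
    change _ * (n * g⁻¹) b = _
    rw [point_mul_apply]
    generalize Coalgebra.comul (R := k) b = z
    induction z with
    | zero => simp
    | add a b ha hb => rw [map_add, mul_add, ha, hb, TensorProduct.tmul_add, map_add, map_add]
    | tmul b c =>
      rw [mulAntipodeOuter_tmul, Algebra.TensorProduct.lift_tmul, Algebra.TensorProduct.lift_tmul,
        map_mul]
      change _ * (_ * g (HopfAlgebra.antipode k c)) = _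
      ring

/-- Right exactness of the tensor product. -/
theorem mem_tensorIdeal_iff (z : X ⊗[k] X) : z ∈ tensorIdeal k I ↔
    Algebra.TensorProduct.map (AlgHom.id k X) (Ideal.Quotient.mkₐ k I) z = 0 := by
  have h := lTensor_exact X (LinearMap.exact_subtype_mkQ (I.restrictScalars k))
    (I.restrictScalars k).mkQ_surjective
  exact (h z).symm

/-- By `conj_apply`, `coadjoint` is the comorphism of (g, n) ↦ gng⁻¹. The converse direction
evaluates stability at the universal pair (g, n), defined over X ⊗ (X ⧸ I). -/
theorem coadjoint_mem_iff_isConjStable :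
    (∀ x ∈ I, coadjoint k X x ∈ tensorIdeal k I) ↔ IsConjStable k I := by
  constructor
  · intro h R _ _ g n hn x hx
    have h1 := (mem_tensorIdeal_iff _).1 (h x hx)
    have h2 := congrArg (Algebra.TensorProduct.lift g.ofConv hn.lift (fun _ _ => .all _ _)) h1
    rw [map_zero] at h2
    rw [conj_apply, ← h2]
    generalize coadjoint k X x = z
    induction z with
    | zero => simp
    | add a b ha hb => rw [map_add, ha, hb, map_add, map_add]
    | tmul a b => rfl
  · intro h x hx
    have := h (X ⊗[k] (X ⧸ I)) (toConv Algebra.TensorProduct.includeLeft)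
      (mapPoint Algebra.TensorProduct.includeRight (quotientPoint k I))
      ((vanishesOn_quotientPoint I).mapPoint _) x hx
    rw [mem_tensorIdeal_iff, ← this, conj_apply]
    generalize coadjoint k X x = z
    induction z with
    | zero => simp
    | add a b ha hb => rw [map_add, ha, hb, map_add]
    | tmul a b =>
      change a ⊗ₜ[k] Ideal.Quotient.mk I b = (a ⊗ₜ[k] 1) * (1 ⊗ₜ[k] Ideal.Quotient.mk I b)
      simp

end Points

/-! ### Kernels of homomorphisms of group schemes -/

section ImageOfAugmentation

variable {k : Type u} [CommRing k] {X W : Type u} [CommRing X] [HopfAlgebra k X]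
  [CommRing W] [HopfAlgebra k W] {R : Type u} [CommRing R] [Algebra k R]

/-- Restriction of points along a homomorphism of Hopf algebras. -/
noncomputable def restrictPoint (f : W →ₐc[k] X) :
    WithConv (X →ₐ[k] R) →* WithConv (W →ₐ[k] R) where
  toFun g := toConv (g.ofConv.comp f)
  map_one' := by
    apply WithConv.ext
    ext x
    change algebraMap k R (Coalgebra.counit (R := k) (f x)) = algebraMap k R (Coalgebra.counit x)
    rw [CoalgHomClass.counit_comp_apply]
  map_mul' g n := WithConv.ext (AlgHom.convMul_comp_bialgHom_distrib g n f)

/-- Restriction of points is a group homomorphism, so it preserves the inverse of the identity point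
of `X`. -/
theorem bialgHom_antipode (f : W →ₐc[k] X) (w : W) :
    f (HopfAlgebra.antipode k w) = HopfAlgebra.antipode k (f w) := by
  have h : restrictPoint f (toConv (AlgHom.id k X))⁻¹ = (restrictPoint f (toConv (.id k X)))⁻¹ :=
    map_inv _ _
  exact (congrArg (fun p : WithConv (W →ₐ[k] X) => p w) h).symm

/-- The ideal of `X` generated by the image of the augmentation ideal of `W`. -/
noncomputable def mapAugmentation (f : W →ₐc[k] X) : Ideal X :=
  Ideal.map (f : W →ₐ[k] X) (RingHom.ker (Bialgebra.counitAlgHom k W))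

/-- Since W⁺ consists of the elements w - ε(w), the ideal cuts out the kernel of restriction of
points. That it is a Hopf ideal and conjugation stable then follows from group theory alone. -/
theorem vanishesOn_mapAugmentation_iff (f : W →ₐc[k] X) (n : WithConv (X →ₐ[k] R)) :
    VanishesOn (mapAugmentation f) n ↔ restrictPoint f n = 1 := by
  have key : VanishesOn (mapAugmentation f) n ↔ mapAugmentation f ≤ RingHom.ker n.ofConv :=
    Iff.rfl
  rw [key, mapAugmentation, Ideal.map_le_iff_le_comap]
  constructor
  · intro h
    apply WithConv.ext
    ext w
    have hw : w - algebraMap k W (Coalgebra.counit w) ∈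
        RingHom.ker (Bialgebra.counitAlgHom k W) := by
      rw [RingHom.mem_ker]
      simp
    have h1 : n.ofConv ((f : W →ₐ[k] X) (w - algebraMap k W (Coalgebra.counit w))) = 0 := h hw
    rw [map_sub, map_sub, AlgHom.commutes, AlgHom.commutes, sub_eq_zero] at h1
    exact h1
  · intro h w hw
    have h1 : n.ofConv (f w) = algebraMap k R (Coalgebra.counit w) :=
      congrArg (fun p : WithConv (W →ₐ[k] R) => p w) h
    have h2 : Coalgebra.counit (R := k) w = 0 := hw
    rw [h2, map_zero] at h1
    exact h1

theorem isHopfIdeal_mapAugmentation (f : W →ₐc[k] X) : (mapAugmentation f).IsHopfIdeal k := by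
  refine isHopfIdeal_of_vanishesOn ?_ ?_ ?_
  · exact (vanishesOn_mapAugmentation_iff f (1 : WithConv (X →ₐ[k] k))).2 (map_one _)
  · intro n m hn hm
    rw [vanishesOn_mapAugmentation_iff] at *
    rw [map_mul, hn, hm]
    exact mul_one (1 : WithConv (W →ₐ[k]
      (X ⧸ mapAugmentation f) ⊗[k] (X ⧸ mapAugmentation f)))
  · intro n hn
    rw [vanishesOn_mapAugmentation_iff] at *
    rw [map_inv, hn, inv_one]

theorem isConjStable_mapAugmentation (f : W →ₐc[k] X) :
    IsConjStable k (mapAugmentation f) := by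
  intro R _ _ g n hn
  rw [vanishesOn_mapAugmentation_iff] at *
  rw [map_mul, map_mul, hn, mul_one, ← map_mul, mul_inv_cancel, map_one]

end ImageOfAugmentation

section Cokernel

variable {k : Type u} [CommRing k] {X W : Type u} [CommRing X] [HopfAlgebra k X]
  [CommRing W] [HopfAlgebra k W]

theorem mapAugmentation_le_ker_iff {Y : Type u} [CommRing Y] [HopfAlgebra k Y] (g : W →ₐc[k] X)
    (f : X →ₐc[k] Y) :
    mapAugmentation g ≤ RingHom.ker (f : X →ₐ[k] Y) ↔
      ∀ w, f (g w) = algebraMap k Y (Coalgebra.counit w) := by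
  refine (vanishesOn_mapAugmentation_iff g (toConv (f : X →ₐ[k] Y))).trans ⟨fun h w => ?_,
    fun h => ?_⟩
  · exact congrArg (fun p : WithConv (W →ₐ[k] Y) => p w) h
  · apply WithConv.ext
    ext w
    exact h w

end Cokernel

/-! ### Hopf subalgebras, images and kernels over a field -/

section HopfSubalgebra

variable {k : Type u} [Field k] {X : Type u} [CommRing X] [HopfAlgebra k X] {A : Subalgebra k X}

/-- Flatness over a field lets A ⊗ A be regarded as part of X ⊗ X, so the Hopf algebra axioms for
`A` are inherited from `X`. -/
theorem map_val_injective (A : Subalgebra k X) :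
    Function.Injective (Algebra.TensorProduct.map A.val A.val) :=
  TensorProduct.map_injective_of_flat_flat A.val.toLinearMap A.val.toLinearMap
    Subtype.val_injective Subtype.val_injective

namespace IsHopfSubalgebra

theorem comul_mem_range (hA : IsHopfSubalgebra A) (a : A) :
    Coalgebra.comul (R := k) (a : X) ∈ (Algebra.TensorProduct.map A.val A.val).range :=
  hA.comul_mem a a.2

/-- The comultiplication of a Hopf subalgebra. -/
noncomputable def comulAlgHom (hA : IsHopfSubalgebra A) : A →ₐ[k] A ⊗[k] A :=
  (AlgEquiv.ofInjective _ (map_val_injective A)).symm.toAlgHom.comp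
    (((Bialgebra.comulAlgHom k X).comp A.val).codRestrict _ hA.comul_mem_range)

theorem map_val_comulAlgHom (hA : IsHopfSubalgebra A) (a : A) :
    Algebra.TensorProduct.map A.val A.val (hA.comulAlgHom a) = Coalgebra.comul (R := k) (a : X) :=
  congrArg Subtype.val ((AlgEquiv.ofInjective _ (map_val_injective A)).apply_symm_apply
    ((((Bialgebra.comulAlgHom k X).comp A.val).codRestrict _ hA.comul_mem_range) a))

theorem coassoc_comulAlgHom (hA : IsHopfSubalgebra A) (a : A) :
    Algebra.TensorProduct.assoc k k k A A A
        (Algebra.TensorProduct.map hA.comulAlgHom (.id k A) (hA.comulAlgHom a)) =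
      Algebra.TensorProduct.map (.id k A) hA.comulAlgHom (hA.comulAlgHom a) := by
  let j := Algebra.TensorProduct.map A.val (Algebra.TensorProduct.map A.val A.val)
  have hj : Function.Injective j :=
    TensorProduct.map_injective_of_flat_flat A.val.toLinearMap
      (Algebra.TensorProduct.map A.val A.val).toLinearMap
      Subtype.val_injective (map_val_injective A)
  have hl : (j.comp (Algebra.TensorProduct.assoc k k k A A A).toAlgHom).comp
      (Algebra.TensorProduct.map hA.comulAlgHom (.id k A)) =
      ((Algebra.TensorProduct.assoc k k k X X X).toAlgHom.comp
        (Algebra.TensorProduct.map (Bialgebra.comulAlgHom k X) (.id k X))).comp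
        (Algebra.TensorProduct.map A.val A.val) := by
    have hj2 : j.comp (Algebra.TensorProduct.assoc k k k A A A).toAlgHom =
        (Algebra.TensorProduct.assoc k k k X X X).toAlgHom.comp
          (Algebra.TensorProduct.map (Algebra.TensorProduct.map A.val A.val) A.val) := by
      ext <;> rfl
    rw [hj2, AlgHom.comp_assoc, AlgHom.comp_assoc, ← Algebra.TensorProduct.map_comp,
      ← Algebra.TensorProduct.map_comp]
    congr 2
    exact AlgHom.ext hA.map_val_comulAlgHom
  have hr : j.comp (Algebra.TensorProduct.map (.id k A) hA.comulAlgHom) =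
      (Algebra.TensorProduct.map (.id k X) (Bialgebra.comulAlgHom k X)).comp
        (Algebra.TensorProduct.map A.val A.val) := by
    rw [← Algebra.TensorProduct.map_comp, ← Algebra.TensorProduct.map_comp]
    congr 1
    exact AlgHom.ext hA.map_val_comulAlgHom
  apply hj
  have h := Coalgebra.coassoc_apply (R := k) (a : X)
  rw [← hA.map_val_comulAlgHom] at h
  exact (DFunLike.congr_fun hl _).trans (h.trans (DFunLike.congr_fun hr _).symm)

/-- The bialgebra structure of a Hopf subalgebra. -/
noncomputable abbrev bialgebra (hA : IsHopfSubalgebra A) : Bialgebra k A :=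
  Bialgebra.ofAlgHom hA.comulAlgHom ((Bialgebra.counitAlgHom k X).comp A.val)
    (AlgHom.ext hA.coassoc_comulAlgHom)
    (by
      ext a
      have hinj : Function.Injective (Algebra.TensorProduct.map (AlgHom.id k k) A.val) :=
        TensorProduct.map_injective_of_flat_flat LinearMap.id A.val.toLinearMap
          Function.injective_id Subtype.val_injective
      apply hinj
      have h := Coalgebra.rTensor_counit_comul (R := k) (a : X)
      rw [← hA.map_val_comulAlgHom] at h
      refine Eq.trans (Eq.trans ?_ h) ?_
      · change Algebra.TensorProduct.map (AlgHom.id k k) A.val (Algebra.TensorProduct.map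
          ((Bialgebra.counitAlgHom k X).comp A.val) (.id k A) (hA.comulAlgHom a)) = _
        generalize hA.comulAlgHom a = z
        induction z with
        | zero => simp
        | add a b ha hb => simp only [map_add, ha, hb]
        | tmul a b => rfl
      · rfl)
    (by
      ext a
      have hinj : Function.Injective (Algebra.TensorProduct.map A.val (AlgHom.id k k)) :=
        TensorProduct.map_injective_of_flat_flat A.val.toLinearMap LinearMap.id
          Subtype.val_injective Function.injective_id
      apply hinj
      have h := Coalgebra.lTensor_counit_comul (R := k) (a : X)
      rw [← hA.map_val_comulAlgHom] at h
      refine Eq.trans (Eq.trans ?_ h) ?_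
      · change Algebra.TensorProduct.map A.val (AlgHom.id k k) (Algebra.TensorProduct.map
          (.id k A) ((Bialgebra.counitAlgHom k X).comp A.val) (hA.comulAlgHom a)) = _
        generalize hA.comulAlgHom a = z
        induction z with
        | zero => simp
        | add a b ha hb => simp only [map_add, ha, hb]
        | tmul a b => rfl
      · rfl)

/-- The antipode of a Hopf subalgebra. -/
noncomputable def antipodeAlgHom (hA : IsHopfSubalgebra A) : A →ₐ[k] A :=
  ((HopfAlgebra.antipodeAlgHom k X).comp A.val).codRestrict A fun a => hA.antipode_mem a a.2

/-- The Hopf algebra structure of a Hopf subalgebra. -/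
noncomputable abbrev hopfAlgebra (hA : IsHopfSubalgebra A) : HopfAlgebra k A :=
  letI := hA.bialgebra
  HopfAlgebra.ofAlgHom hA.antipodeAlgHom
    (by
      ext a
      have h := HopfAlgebra.mul_antipode_rTensor_comul_apply (R := k) (a : X)
      rw [← hA.map_val_comulAlgHom] at h
      refine Eq.trans ?_ h
      change A.val (Algebra.TensorProduct.lift hA.antipodeAlgHom (.id k A)
        (fun _ => Commute.all _) (hA.comulAlgHom a)) = _
      generalize hA.comulAlgHom a = z
      induction z with
      | zero => simp
      | add a b ha hb => simp only [map_add, ha, hb]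
      | tmul a b =>
        change A.val (_ * _) = _
        rw [map_mul]
        rfl)
    (by
      ext a
      have h := HopfAlgebra.mul_antipode_lTensor_comul_apply (R := k) (a : X)
      rw [← hA.map_val_comulAlgHom] at h
      refine Eq.trans ?_ h
      change A.val (Algebra.TensorProduct.lift (.id k A) hA.antipodeAlgHom
        (fun _ _ => Commute.all _ _) (hA.comulAlgHom a)) = _
      generalize hA.comulAlgHom a = z
      induction z with
      | zero => simp
      | add a b ha hb => simp only [map_add, ha, hb]
      | tmul a b =>
        change A.val (_ * _) = _
        rw [map_mul]
        rfl)

/-- The inclusion of a Hopf subalgebra. -/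
noncomputable def valBialgHom (hA : IsHopfSubalgebra A) :
    letI := hA.hopfAlgebra
    A →ₐc[k] X :=
  letI := hA.hopfAlgebra
  BialgHom.ofAlgHom A.val rfl (AlgHom.ext fun a => hA.map_val_comulAlgHom a)

end IsHopfSubalgebra

variable {W : Type u} [CommRing W] [HopfAlgebra k W]

theorem isHopfSubalgebra_range (g : W →ₐc[k] X) :
    IsHopfSubalgebra (g : W →ₐ[k] X).range where
  comul_mem := by
    rintro _ ⟨w, rfl⟩
    have h : Coalgebra.comul (R := k) (g w) = TensorProduct.map g.toLinearMap g.toLinearMap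
      (Coalgebra.comul w) := (CoalgHomClass.map_comp_comul_apply g w).symm
    change Coalgebra.comul (R := k) (g w) ∈ _
    rw [h]
    generalize Coalgebra.comul (R := k) w = z
    induction z with
    | zero => simp
    | add a b ha hb => rw [map_add]; exact add_mem ha hb
    | tmul a b => exact ⟨(⟨g a, a, rfl⟩ : (g : W →ₐ[k] X).range) ⊗ₜ
        (⟨g b, b, rfl⟩ : (g : W →ₐ[k] X).range), rfl⟩
  antipode_mem := by
    rintro _ ⟨w, rfl⟩
    exact ⟨HopfAlgebra.antipode k w, bialgHom_antipode g w⟩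

theorem mapAugmentation_eq_map_range (g : W →ₐc[k] X) :
    mapAugmentation g =
      Ideal.map (g : W →ₐ[k] X).range.val (augmentationIdeal (g : W →ₐ[k] X).range) := by
  apply le_antisymm
  · rw [mapAugmentation, Ideal.map_le_iff_le_comap]
    intro w hw
    refine Ideal.mem_map_of_mem (g : W →ₐ[k] X).range.val
      (x := (⟨g w, w, rfl⟩ : (g : W →ₐ[k] X).range)) ?_
    change Coalgebra.counit (R := k) (g w) = 0
    rw [CoalgHomClass.counit_comp_apply]
    exact hw
  · rw [Ideal.map_le_iff_le_comap]
    rintro ⟨_, w, rfl⟩ hw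
    refine Ideal.mem_map_of_mem (g : W →ₐ[k] X) ?_
    have h : Coalgebra.counit (R := k) (g w) = 0 := hw
    rw [CoalgHomClass.counit_comp_apply] at h
    exact h

/-- X ⧸ ker f embeds in `W`, and over a field so does its tensor square in W ⊗ W, where Δ(x) can be
seen to vanish. -/
theorem isHopfIdeal_ker (f : X →ₐc[k] W) : (RingHom.ker (f : X →ₐ[k] W)).IsHopfIdeal k where
  counit_eq_zero x hx := by
    have hx0 : f x = 0 := hx
    rw [← CoalgHomClass.counit_comp_apply f x, hx0, map_zero]
  map_mkQ_comul_eq_zero x hx := by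
    have hx0 : f x = 0 := hx
    let I := RingHom.ker (f : X →ₐ[k] W)
    let q := Ideal.Quotient.mkₐ k I
    let i : (X ⧸ I) →ₐ[k] W := Ideal.kerLiftAlg (f : X →ₐ[k] W)
    have hi : Function.Injective i := Ideal.kerLiftAlg_injective _
    have hinj : Function.Injective (Algebra.TensorProduct.map i i) :=
      TensorProduct.map_injective_of_flat_flat i.toLinearMap i.toLinearMap hi hi
    change Algebra.TensorProduct.map q q (Coalgebra.comul (R := k) x) = 0
    apply hinj
    have h := CoalgHomClass.map_comp_comul_apply f x
    rw [hx0, map_zero] at h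
    rw [map_zero, ← h]
    generalize Coalgebra.comul (R := k) x = z
    induction z with
    | zero => simp
    | add a b ha hb => simp only [map_add, ha, hb]
    | tmul a b => rfl
  antipode_mem x hx := by
    have hx0 : f x = 0 := hx
    change f (HopfAlgebra.antipode k x) = 0
    rw [bialgHom_antipode, hx0, map_zero]

theorem IsHopfIdeal.ideal_isHopfIdeal {I : Ideal X} (hI : IsHopfIdeal k I) : I.IsHopfIdeal k := by
  obtain ⟨Y, f, hf⟩ := hI
  obtain rfl : I = RingHom.ker (f.hom : X →ₐ[k] Y) := SetLike.coe_injective hf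
  exact isHopfIdeal_ker f.hom

end HopfSubalgebra

/-! ### Cokernels as quotients by the ideal generated by an augmentation ideal -/

section Cokernel

variable {k : Type u} [CommRing k] {X : Type u} [CommRing X] [HopfAlgebra k X] {I : Ideal X}

theorem IsNormalHopfIdeal.exists_eq_mapAugmentation (hI : IsNormalHopfIdeal k I) :
    ∃ (W : CommHopfAlgCat.{u} k) (g : W →ₐc[k] X), I = mapAugmentation g := by
  obtain ⟨Y, f, ⟨hf⟩, hIf⟩ := hI
  refine ⟨hf.W, hf.g.hom, ?_⟩
  have hIk : I = RingHom.ker (f.hom : X →ₐ[k] Y) := SetLike.coe_injective hIf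
  apply le_antisymm
  · have := isHopfIdeal_mapAugmentation hf.g.hom
    let q : CommHopfAlgCat.of k X ⟶ CommHopfAlgCat.of k (X ⧸ mapAugmentation hf.g.hom) :=
      CommHopfAlgCat.ofHom (Bialgebra.Quotient.mkBialgHom (mapAugmentation hf.g.hom))
    have hq : hf.g ≫ q = 0 := by
      apply CommHopfAlgCat.hom_ext
      apply BialgHom.ext
      refine (mapAugmentation_le_ker_iff hf.g.hom q.hom).1 ?_
      intro x hx
      exact Ideal.Quotient.eq_zero_iff_mem.2 hx
    -- The quotient map `q` kills `hf.g`, so it factors through the cokernel `f`; hence ker f lies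
    -- in the ideal.
    have hfac := hf.isColimit.fac (CokernelCofork.ofπ q hq) WalkingParallelPair.one
    intro x hx
    rw [hIk] at hx
    have hx0 : f.hom x = 0 := hx
    have h := congrArg (fun p : CommHopfAlgCat.of k X ⟶ _ => p.hom x) hfac
    have h1 : (hf.isColimit.desc (CokernelCofork.ofπ q hq)).hom (f.hom x) = q.hom x := h
    rw [hx0, map_zero] at h1
    exact Ideal.Quotient.eq_zero_iff_mem.1 h1.symm
  · rw [hIk]
    refine (mapAugmentation_le_ker_iff hf.g.hom f.hom).2 fun w => ?_
    exact congrArg (fun p : hf.W ⟶ Y => p.hom w) hf.w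

theorem isNormalHopfIdeal_mapAugmentation {W : Type u} [CommRing W] [HopfAlgebra k W]
    (g : W →ₐc[k] X) : IsNormalHopfIdeal k (mapAugmentation g) := by
  have := isHopfIdeal_mapAugmentation g
  let q : CommHopfAlgCat.of k X ⟶ CommHopfAlgCat.of k (X ⧸ mapAugmentation g) :=
    CommHopfAlgCat.ofHom (Bialgebra.Quotient.mkBialgHom (mapAugmentation g))
  have hqs : Function.Surjective q.hom := Ideal.Quotient.mk_surjective
  have hq : CommHopfAlgCat.ofHom g ≫ q = 0 := by
    apply CommHopfAlgCat.hom_ext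
    apply BialgHom.ext
    refine (mapAugmentation_le_ker_iff g q.hom).1 ?_
    intro x hx
    exact Ideal.Quotient.eq_zero_iff_mem.2 hx
  have : Epi q := ConcreteCategory.epi_of_surjective q hqs
  refine ⟨_, q, ⟨⟨_, CommHopfAlgCat.ofHom g, hq, ?_⟩⟩, ?_⟩
  · refine CokernelCofork.IsColimit.ofπ' q hq fun {Z} h hh => ?_
    have hle : mapAugmentation g ≤ RingHom.ker (h.hom : X →ₐ[k] Z) :=
      (mapAugmentation_le_ker_iff g h.hom).2 fun w =>
        congrArg (fun p : CommHopfAlgCat.of k W ⟶ Z => p.hom w) hh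
    let d : (X ⧸ mapAugmentation g) →ₐ[k] Z := Ideal.Quotient.liftₐ _ (h.hom : X →ₐ[k] Z) hle
    refine ⟨CommHopfAlgCat.ofHom (BialgHom.ofAlgHom d ?_ ?_), ?_⟩
    · refine Ideal.Quotient.algHom_ext k ?_
      ext x
      exact CoalgHomClass.counit_comp_apply h.hom x
    · refine Ideal.Quotient.algHom_ext k ?_
      ext x
      refine Eq.trans ?_ (CoalgHomClass.map_comp_comul_apply h.hom x)
      change Algebra.TensorProduct.map d d (Algebra.TensorProduct.map (Ideal.Quotient.mkₐ k _)
        (Ideal.Quotient.mkₐ k _) (Coalgebra.comul (R := k) x)) = _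
      generalize Coalgebra.comul (R := k) x = z
      induction z with
      | zero => simp
      | add a b ha hb => simp only [map_add, ha, hb]
      | tmul a b => rfl
    · rfl
  · ext x
    exact Ideal.Quotient.eq_zero_iff_mem.symm

end Cokernel

/-! ### Contractions of tensors with linear forms -/

section Slices

variable {k : Type u} [Field k] {V M N : Type u} [AddCommGroup V] [Module k V]
  [AddCommGroup M] [Module k M] [AddCommGroup N] [Module k N]

/-- Contraction of the left factor of a tensor product with a linear form. -/
noncomputable def sliceLeft (M : Type u) [AddCommGroup M] [Module k M] (φ : Module.Dual k V) :
    V ⊗[k] M →ₗ[k] M :=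
  (TensorProduct.lid k M).toLinearMap ∘ₗ φ.rTensor M

/-- Contraction of the right factor of a tensor product with a linear form. -/
noncomputable def sliceRight (M : Type u) [AddCommGroup M] [Module k M] (φ : Module.Dual k V) :
    M ⊗[k] V →ₗ[k] M :=
  (TensorProduct.rid k M).toLinearMap ∘ₗ φ.lTensor M

@[simp]
theorem sliceLeft_tmul (φ : Module.Dual k V) (v : V) (m : M) :
    sliceLeft M φ (v ⊗ₜ m) = φ v • m := by
  simp [sliceLeft]

@[simp]
theorem sliceRight_tmul (φ : Module.Dual k V) (v : V) (m : M) :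
    sliceRight M φ (m ⊗ₜ v) = φ v • m := by
  simp [sliceRight]

theorem sliceLeft_lTensor (φ : Module.Dual k V) (f : M →ₗ[k] N) (z : V ⊗[k] M) :
    sliceLeft N φ (f.lTensor V z) = f (sliceLeft M φ z) := by
  induction z with
  | zero => simp
  | add a b ha hb => simp only [map_add, ha, hb]
  | tmul a b => simp

theorem sliceRight_rTensor (φ : Module.Dual k V) (f : M →ₗ[k] N) (z : M ⊗[k] V) :
    sliceRight N φ (f.rTensor V z) = f (sliceRight M φ z) := by
  induction z with
  | zero => simp
  | add a b ha hb => simp only [map_add, ha, hb]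
  | tmul a b => simp

theorem eq_of_sliceRight_eq {y z : M ⊗[k] V} (h : ∀ φ, sliceRight M φ y = sliceRight M φ z) :
    y = z := by
  let b := Module.Free.chooseBasis k V
  apply (TensorProduct.equivFinsuppOfBasisRight b).injective
  ext i
  have key : ∀ w : M ⊗[k] V,
      TensorProduct.equivFinsuppOfBasisRight b w i = sliceRight M (b.coord i) w := by
    intro w
    induction w with
    | zero => simp
    | add a b ha hb => simp only [map_add, Finsupp.add_apply, ha, hb]
    | tmul m v => simp
  rw [key, key, h]

theorem eq_of_sliceLeft_eq {y z : V ⊗[k] M} (h : ∀ φ, sliceLeft M φ y = sliceLeft M φ z) :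
    y = z := by
  apply (TensorProduct.comm k V M).injective
  apply eq_of_sliceRight_eq
  intro φ
  have key : ∀ w : V ⊗[k] M, sliceRight M φ (TensorProduct.comm k V M w) = sliceLeft M φ w := by
    intro w
    induction w with
    | zero => simp
    | add a b ha hb => simp only [map_add, ha, hb]
    | tmul m v => simp
  rw [key, key, h]

theorem rTensor_eq_self {e : M →ₗ[k] M} {z : M ⊗[k] V}
    (h : ∀ φ, e (sliceRight M φ z) = sliceRight M φ z) : e.rTensor V z = z :=
  eq_of_sliceRight_eq fun φ => (sliceRight_rTensor φ e z).trans (h φ)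

theorem lTensor_eq_self {e : M →ₗ[k] M} {z : V ⊗[k] M}
    (h : ∀ φ, e (sliceLeft M φ z) = sliceLeft M φ z) : e.lTensor V z = z :=
  eq_of_sliceLeft_eq fun φ => (sliceLeft_lTensor φ e z).trans (h φ)

theorem exists_projection (A : Submodule k M) :
    ∃ p : M →ₗ[k] A, ∀ a : A, p a = a := by
  obtain ⟨p, hp⟩ := A.subtype.exists_leftInverse_of_injective (Submodule.ker_subtype A)
  exact ⟨p, fun a => DFunLike.congr_fun hp a⟩

theorem mem_range_rTensor_subtype (A : Submodule k M) {z : M ⊗[k] V}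
    (h : ∀ φ, sliceRight M φ z ∈ A) : ∃ y : A ⊗[k] V, A.subtype.rTensor V y = z := by
  obtain ⟨p, hp⟩ := exists_projection A
  refine ⟨p.rTensor V z, ?_⟩
  rw [← LinearMap.rTensor_comp_apply]
  exact rTensor_eq_self fun φ => congrArg Subtype.val (hp ⟨_, h φ⟩)

/-- A linear projection onto `A` fixes every slice of `z`, so applying it in either factor fixes
`z`. -/
theorem mem_range_mapIncl (A : Submodule k M) {z : M ⊗[k] M}
    (hl : ∀ φ, sliceLeft M φ z ∈ A) (hr : ∀ φ, sliceRight M φ z ∈ A) :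
    z ∈ LinearMap.range (TensorProduct.mapIncl A A) := by
  obtain ⟨p, hp⟩ := exists_projection A
  refine ⟨TensorProduct.map p p z, ?_⟩
  have h1 : (A.subtype ∘ₗ p).rTensor M z = z :=
    rTensor_eq_self fun φ => congrArg Subtype.val (hp ⟨_, hr φ⟩)
  have h2 : (A.subtype ∘ₗ p).lTensor M z = z :=
    lTensor_eq_self fun φ => congrArg Subtype.val (hp ⟨_, hl φ⟩)
  conv_rhs => rw [← h1, ← h2]
  rw [TensorProduct.mapIncl, ← LinearMap.comp_apply, ← LinearMap.comp_apply,
    ← TensorProduct.map_comp, LinearMap.rTensor_comp_lTensor]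

theorem finite_span_range_sliceRight (z : M ⊗[k] V) :
    FiniteDimensional k (Submodule.span k (Set.range fun φ => sliceRight M φ z)) := by
  suffices h : ∃ F : Submodule k M, FiniteDimensional k F ∧ ∀ φ, sliceRight M φ z ∈ F by
    obtain ⟨F, hF, h⟩ := h
    exact Submodule.finiteDimensional_of_le (Submodule.span_le.2 (Set.range_subset_iff.2 h))
  induction z with
  | zero => exact ⟨⊥, inferInstance, fun φ => by simp⟩
  | add a b ha hb =>
    obtain ⟨F, hF, h⟩ := ha
    obtain ⟨G, hG, h'⟩ := hb
    exact ⟨F ⊔ G, inferInstance, fun φ => by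
      rw [map_add]
      exact Submodule.add_mem_sup (h φ) (h' φ)⟩
  | tmul m v =>
    exact ⟨Submodule.span k {m}, inferInstance, fun φ => by
      rw [sliceRight_tmul]
      exact Submodule.smul_mem _ _ (Submodule.mem_span_singleton_self m)⟩

theorem exists_dual_family {ι : Type} [Fintype ι] [DecidableEq ι] {v : ι → M}
    (hv : LinearIndependent k v) :
    ∃ φ : ι → Module.Dual k M, ∀ i j, φ i (v j) = if i = j then 1 else 0 := by
  let b := Module.Basis.span hv
  have hb : ∀ i, ∃ φ : Module.Dual k M, φ ∘ₗ (Submodule.span k (Set.range v)).subtype = b.coord i :=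
    fun i => LinearMap.exists_extend (b.coord i)
  choose φ hφ using hb
  refine ⟨φ, fun i j => ?_⟩
  have h := DFunLike.congr_fun (hφ i) (b j)
  rw [Module.Basis.coord_apply, Module.Basis.repr_self, Finsupp.single_apply] at h
  rw [LinearMap.comp_apply, Submodule.subtype_apply, Module.Basis.span_apply] at h
  rw [h]
  simp [eq_comm]

end Slices

/-! ### Translates, semi-invariants and the algebra of coinvariants -/

section Translates

variable {k : Type u} [Field k] {X : Type u} [CommRing X] [HopfAlgebra k X]
  {R : Type u} [CommRing R] [Algebra k R]

theorem sliceLeft_mul_includeRight {V : Type u} [CommRing V] [Algebra k V] (φ : Module.Dual k V)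
    (z : V ⊗[k] R) (r : R) :
    sliceLeft R φ (z * Algebra.TensorProduct.includeRight r) = sliceLeft R φ z * r := by
  induction z with
  | zero => simp
  | add a b ha hb => rw [add_mul, map_add, map_add, ha, hb, add_mul]
  | tmul a b => simp

theorem sliceRight_includeLeft_mul {V : Type u} [CommRing V] [Algebra k V] (φ : Module.Dual k V)
    (z : R ⊗[k] V) (r : R) :
    sliceRight R φ ((Algebra.TensorProduct.includeLeft : R →ₐ[k] R ⊗[k] V) r * z) =
      r * sliceRight R φ z := by
  induction z with
  | zero => simp
  | add a b ha hb => rw [mul_add, map_add, map_add, ha, hb, mul_add]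
  | tmul a b => simp

variable (k X R) in
/-- The generic point of `X`, with coefficients extended to `R`. -/
noncomputable def genericPoint : WithConv (X →ₐ[k] X ⊗[k] R) :=
  toConv Algebra.TensorProduct.includeLeft

variable (k X) in
/-- Extension of coefficients of a point along `R → X ⊗ R`. -/
noncomputable def extendPoint (g : WithConv (X →ₐ[k] R)) : WithConv (X →ₐ[k] X ⊗[k] R) :=
  mapPoint (Algebra.TensorProduct.includeRight : R →ₐ[k] X ⊗[k] R) g

theorem extendPoint_apply (g : WithConv (X →ₐ[k] R)) (x : X) :
    extendPoint k X g x = (Algebra.TensorProduct.includeRight : R →ₐ[k] X ⊗[k] R) (g x) := rfl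

theorem extendPoint_mul (g n : WithConv (X →ₐ[k] R)) :
    extendPoint k X (g * n) = extendPoint k X g * extendPoint k X n := map_mul _ _ _

theorem VanishesOn.extendPoint {I : Ideal X} {n : WithConv (X →ₐ[k] R)} (hn : VanishesOn I n) :
    VanishesOn I (extendPoint k X n) := hn.mapPoint _

/-- Left translation by the generic point of `X`. -/
theorem sliceLeft_generic_mul (φ : Module.Dual k X) (g : WithConv (X →ₐ[k] R)) (x : X) :
    sliceLeft R φ ((genericPoint k X R * extendPoint k X g) x) =
      g (sliceLeft X φ (Coalgebra.comul x)) := by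
  rw [point_mul_apply]
  generalize Coalgebra.comul (R := k) x = z
  induction z with
  | zero => simp
  | add a b ha hb => simp only [map_add, ha, hb]
  | tmul a b =>
    rw [Algebra.TensorProduct.lift_tmul, sliceLeft_tmul, map_smul]
    refine (sliceLeft_mul_includeRight φ _ (g b)).trans ?_
    change sliceLeft R φ (a ⊗ₜ 1) * _ = _
    simp

/-- Right translation by the generic point of `X`. -/
theorem sliceLeft_mul_generic (φ : Module.Dual k X) (g : WithConv (X →ₐ[k] R)) (x : X) :
    sliceLeft R φ ((extendPoint k X g * genericPoint k X R) x) =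
      g (sliceRight X φ (Coalgebra.comul x)) := by
  rw [point_mul_apply]
  generalize Coalgebra.comul (R := k) x = z
  induction z with
  | zero => simp
  | add a b ha hb => simp only [map_add, ha, hb]
  | tmul a b =>
    rw [Algebra.TensorProduct.lift_tmul, sliceRight_tmul, map_smul, mul_comm]
    refine (sliceLeft_mul_includeRight φ _ (g a)).trans ?_
    change sliceLeft R φ (b ⊗ₜ 1) * _ = _
    simp

/-- `c` satisfies `c(g n) a(n) = c(g) b(n)` for all points `g` of `X` and `n` of `X ⧸ I`. -/
def IsSemiInvariant (I : Ideal X) (a b c : X) : Prop :=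
  ∀ (R : Type u) [CommRing R] [Algebra k R] (g n : WithConv (X →ₐ[k] R)), VanishesOn I n →
    (g * n) c * n a = g c * n b

variable {I : Ideal X}

/-- Left translation commutes with right translation by N. The generic point supplies all left
translates at once, and `φ` contracts its coefficients. -/
theorem IsSemiInvariant.sliceLeft_comul {a b c : X} (h : IsSemiInvariant (k := k) I a b c)
    (φ : Module.Dual k X) :
    IsSemiInvariant (k := k) I a b (sliceLeft X φ (Coalgebra.comul c)) := by
  intro R _ _ g n hn
  have h1 := h (X ⊗[k] R) (genericPoint k X R * extendPoint k X g) (extendPoint k X n)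
    hn.extendPoint
  have h2 := congrArg (sliceLeft R φ) h1
  rw [mul_assoc, ← extendPoint_mul, extendPoint_apply, extendPoint_apply] at h2
  rw [sliceLeft_mul_includeRight, sliceLeft_mul_includeRight, sliceLeft_generic_mul,
    sliceLeft_generic_mul] at h2
  exact h2

theorem counit_sliceLeft_comul (φ : Module.Dual k X) (x : X) :
    Coalgebra.counit (R := k) (sliceLeft X φ (Coalgebra.comul x)) = φ x := by
  rw [← sliceLeft_lTensor, Coalgebra.lTensor_counit_comul]
  simp

variable (k) in
/-- The functions on the quotient by the closed subgroup cut out by `I`. -/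
def coinvariants (I : Ideal X) : Subalgebra k X where
  carrier := {x | ∀ (R : Type u) [CommRing R] [Algebra k R] (g n : WithConv (X →ₐ[k] R)),
    VanishesOn I n → (g * n) x = g x}
  mul_mem' {x y} hx hy R _ _ g n hn := by rw [map_mul, map_mul, hx R g n hn, hy R g n hn]
  add_mem' {x y} hx hy R _ _ g n hn := by rw [map_add, map_add, hx R g n hn, hy R g n hn]
  algebraMap_mem' r R _ _ g n hn := by rw [AlgHom.commutes, AlgHom.commutes]

theorem mem_coinvariants_iff_isSemiInvariant {x : X} :
    x ∈ coinvariants k I ↔ IsSemiInvariant (k := k) I 1 1 x := by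
  refine forall_congr' fun R => forall_congr' fun _ => forall_congr' fun _ =>
    forall_congr' fun g => forall_congr' fun n => forall_congr' fun _ => ?_
  rw [map_one, mul_one, mul_one]

theorem IsConjStable.inv_mul_mul (hI : IsConjStable k I) {g n : WithConv (X →ₐ[k] R)}
    (hn : VanishesOn I n) : VanishesOn I (g⁻¹ * n * g) := by
  simpa using hI R g⁻¹ n hn

/-- Left translates of invariants are invariant for any N; right translates and inverses require
normality, to carry an element of N across a point of G. -/
theorem isHopfSubalgebra_coinvariants [I.IsHopfIdeal k] (hI : IsConjStable k I) :
    IsHopfSubalgebra (coinvariants k I) where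
  comul_mem x hx := by
    refine mem_range_mapIncl _ (fun φ => ?_) fun φ => ?_
    · exact mem_coinvariants_iff_isSemiInvariant.2
        ((mem_coinvariants_iff_isSemiInvariant.1 hx).sliceLeft_comul φ)
    · intro R _ _ g n hn
      let h := genericPoint k X R
      -- Right translation by `h` turns gn into gnh = gh(h⁻¹nh), and h⁻¹nh lies again in N.
      have h1 := hx (X ⊗[k] R) (extendPoint k X g * h) (h⁻¹ * extendPoint k X n * h)
        (hI.inv_mul_mul hn.extendPoint)
      have h2 : extendPoint k X g * h * (h⁻¹ * extendPoint k X n * h) =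
          extendPoint k X (g * n) * h := by
        rw [extendPoint_mul]
        group
      rw [← sliceLeft_mul_generic, ← sliceLeft_mul_generic, ← h1, h2]
  antipode_mem x hx R _ _ g n hn := by
    change (g * n)⁻¹ x = g⁻¹ x
    rw [← hx R g⁻¹ (g * n⁻¹ * g⁻¹) (hI R g _ hn.inv)]
    congr 2
    group

/-- Invariance at g = 1: an invariant function is constant on N. -/
theorem counit_eq_of_mem [I.IsHopfIdeal k] {x : X} (hx : x ∈ coinvariants k I) :
    Ideal.Quotient.mk I x = algebraMap k _ (Coalgebra.counit x) := by
  have h := hx _ 1 (quotientPoint k I) (vanishesOn_quotientPoint I)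
  rwa [one_mul, quotientPoint_apply, point_one_apply] at h

theorem map_augmentationIdeal_coinvariants_le [I.IsHopfIdeal k] :
    Ideal.map (coinvariants k I).val (augmentationIdeal (coinvariants k I)) ≤ I := by
  rw [Ideal.map_le_iff_le_comap]
  rintro ⟨x, hx⟩ h
  have h0 : Coalgebra.counit (R := k) x = 0 := h
  have h1 := counit_eq_of_mem hx
  rw [h0, map_zero] at h1
  exact (Ideal.Quotient.eq_zero_iff_mem (I := I)).1 h1

end Translates

/-- A finite-dimensional augmented commutative algebra has a nonzero element annihilated by the
augmentation ideal. -/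
theorem exists_ne_zero_forall_mul_eq_smul {k : Type u} [Field k] {B : Type u} [CommRing B]
    [Algebra k B] [FiniteDimensional k B] (ε : B →ₐ[k] k) :
    ∃ s : B, s ≠ 0 ∧ ∀ b, s * b = ε b • s := by
  have : IsArtinianRing B := IsArtinianRing.of_finite k B
  have hmax : (RingHom.ker ε).IsMaximal :=
    RingHom.ker_isMaximal_of_surjective ε fun r => ⟨algebraMap k B r, ε.commutes r⟩
  -- Primes of an Artinian ring are maximal, so ker ε is a minimal prime, hence an associated prime:
  -- it is the annihilator of some `s`.
  have hmin : RingHom.ker ε ∈ (Module.annihilator B B).minimalPrimes := by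
    refine ⟨⟨hmax.isPrime, ?_⟩, fun J hJ hle => ?_⟩
    · rw [Module.annihilator_eq_bot.2 inferInstance]
      exact bot_le
    · have := hJ.1
      exact ((IsArtinianRing.isMaximal_of_isPrime J).eq_of_le hmax.ne_top hle).ge
  obtain ⟨-, s, hs⟩ := Submodule.isAssociatedPrime_iff.1
    (Module.associatedPrimes.minimalPrimes_annihilator_subset_associatedPrimes B B hmin)
  have hs' : ∀ b, ε b = 0 ↔ b * s = 0 := fun b => by
    rw [← RingHom.mem_ker, hs, Submodule.mem_colon_singleton, Submodule.mem_bot, smul_eq_mul]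
  refine ⟨s, ?_, fun b => ?_⟩
  · rintro rfl
    exact one_ne_zero ((map_one ε).symm.trans ((hs' 1).2 (mul_zero 1)))
  · have h := (hs' (b - algebraMap k B (ε b))).1 (by simp)
    rw [sub_mul, sub_eq_zero, ← Algebra.smul_def] at h
    rw [mul_comm, h]

/-! ### Conjugates of a character and a semi-invariant of inverse weight -/

section ConjugateCharacter

variable {k : Type u} [Field k] {X : Type u} [CommRing X] [HopfAlgebra k X]
  {R S : Type u} [CommRing R] [Algebra k R] [CommRing S] [Algebra k S]

/-- The inclusion of the left factor, as a homomorphism of `k`-algebras. -/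
noncomputable abbrev leftInclusion (k R V : Type u) [Field k] [CommRing R] [Algebra k R] [CommRing V]
    [Algebra k V] : R →ₐ[k] R ⊗[k] V := Algebra.TensorProduct.includeLeft

theorem map_conj_apply (h : R →ₐ[k] S) (g n : WithConv (X →ₐ[k] R)) (c : X) :
    h ((g * n * g⁻¹) c) = (mapPoint h g * mapPoint h n * (mapPoint h g)⁻¹) c := by
  rw [← map_mul, ← map_inv, ← map_mul]
  rfl

section Family

variable {H : Type u} [CommRing H] [Algebra k H]

variable (R) in
/-- A point of `X` over `H`, with coefficients extended to `R ⊗ H`. -/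
noncomputable def rightPoint (q : WithConv (X →ₐ[k] H)) : WithConv (X →ₐ[k] R ⊗[k] H) :=
  mapPoint (Algebra.TensorProduct.includeRight : H →ₐ[k] R ⊗[k] H) q

/-- The value `c(g q g⁻¹)` in `R ⊗ H`, for points `g` over `R` and `q` over `H`. -/
noncomputable def conjValue (q : WithConv (X →ₐ[k] H)) (c : X) (g : WithConv (X →ₐ[k] R)) :
    R ⊗[k] H :=
  (mapPoint (leftInclusion k R H) g * rightPoint R q * (mapPoint (leftInclusion k R H) g)⁻¹) c

theorem map_conjValue (q : WithConv (X →ₐ[k] H)) (c : X) (h : R →ₐ[k] S)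
    (g : WithConv (X →ₐ[k] R)) :
    Algebra.TensorProduct.map h (.id k H) (conjValue q c g) = conjValue q c (mapPoint h g) := by
  let t := Algebra.TensorProduct.map h (.id k H)
  have h1 : mapPoint t (mapPoint (leftInclusion k R H) g) =
      mapPoint (leftInclusion k S H) (mapPoint h g) := by
    apply WithConv.ext
    ext x
    change t (g x ⊗ₜ 1) = h (g x) ⊗ₜ 1
    simp [t]
  have h2 : mapPoint t (rightPoint R q) = rightPoint S q := by
    apply WithConv.ext
    ext x
    change t (1 ⊗ₜ q x) = 1 ⊗ₜ q x
    simp [t]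
  rw [conjValue.eq_def q c (mapPoint h g), ← h1, ← h2]
  exact map_conj_apply t _ _ c

theorem lift_conjValue (q : WithConv (X →ₐ[k] H)) (c : X) (g : WithConv (X →ₐ[k] R))
    (r : H →ₐ[k] R) :
    Algebra.TensorProduct.lift (.id k R) r (fun _ _ => .all _ _) (conjValue q c g) =
      (g * mapPoint r q * g⁻¹) c := by
  let t := Algebra.TensorProduct.lift (.id k R) r (fun _ _ => .all _ _)
  have h1 : mapPoint t (mapPoint (leftInclusion k R H) g) = g := by
    apply WithConv.ext
    ext x
    change t (g x ⊗ₜ 1) = g x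
    simp [t]
  have h2 : mapPoint t (rightPoint R q) = mapPoint r q := by
    apply WithConv.ext
    ext x
    change t (1 ⊗ₜ q x) = r (q x)
    simp [t]
  conv_rhs => rw [← h2]
  conv_rhs => rw [← h1]
  exact map_conj_apply t _ _ c

/-- The coefficients of the family of functions `q ↦ c(g q g⁻¹)`. -/
noncomputable def conjCoeff (q : WithConv (X →ₐ[k] H)) (c : X) (φ : Module.Dual k H) : X :=
  sliceRight X φ (conjValue q c (toConv (AlgHom.id k X)))

/-- Naturality in the coefficient ring reduces every `g` to the identity point of `X`. -/
theorem point_conjCoeff (q : WithConv (X →ₐ[k] H)) (c : X) (φ : Module.Dual k H)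
    (g : WithConv (X →ₐ[k] R)) :
    g (conjCoeff q c φ) = sliceRight R φ (conjValue q c g) := by
  have h : conjValue q c g = _ := (map_conjValue q c g.ofConv (toConv (AlgHom.id k X))).symm
  rw [h]
  exact (sliceRight_rTensor φ g.ofConv.toLinearMap _).symm

theorem counit_conjCoeff (q : WithConv (X →ₐ[k] H)) (c : X) (φ : Module.Dual k H) :
    Coalgebra.counit (R := k) (conjCoeff q c φ) = φ (q c) := by
  refine (point_conjCoeff q c φ (1 : WithConv (X →ₐ[k] k))).trans ?_
  rw [conjValue, map_one, one_mul, inv_one, mul_one]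
  change sliceRight k φ (1 ⊗ₜ q c) = _
  simp

end Family

variable {I : Ideal X} {c : X}

theorem IsSemiInvariant.mul_apply (hc : IsSemiInvariant (k := k) I 1 c c)
    (n : WithConv (X →ₐ[k] R)) {m : WithConv (X →ₐ[k] R)} (hm : VanishesOn I m) :
    (n * m) c = n c * m c := by
  have h := hc R n m hm
  rwa [map_one, mul_one] at h

theorem IsSemiInvariant.conj_mul (hc : IsSemiInvariant (k := k) I 1 c c) (hI : IsConjStable k I)
    (g n : WithConv (X →ₐ[k] R)) {m : WithConv (X →ₐ[k] R)} (hm : VanishesOn I m) :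
    (g * (n * m) * g⁻¹) c = (g * n * g⁻¹) c * (g * m * g⁻¹) c := by
  rw [← hc.mul_apply _ (hI R g m hm)]
  congr 2
  group

theorem IsSemiInvariant.inv_apply_mul (hc : IsSemiInvariant (k := k) I 1 c c)
    (hε : Coalgebra.counit (R := k) c = 1) {n : WithConv (X →ₐ[k] R)} (hn : VanishesOn I n) :
    n⁻¹ c * n c = 1 := by
  rw [← hc.mul_apply n⁻¹ hn, inv_mul_cancel, point_one_apply, hε, map_one]

section

variable {H : Type u} [CommRing H]

variable [I.IsHopfIdeal k] (hI : IsConjStable k I) (hc : IsSemiInvariant (k := k) I 1 c c)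
  (hε : Coalgebra.counit (R := k) c = 1)

include hI hc hε in
-- Replacing g by gm conjugates gqg⁻¹ by gmg⁻¹, which lies in N by normality, and a character of N
-- does not change under conjugation by N.
theorem conjCoeff_mem_coinvariants [Algebra k H] {q : WithConv (X →ₐ[k] H)}
    (hq : VanishesOn I q) (φ : Module.Dual k H) : conjCoeff q c φ ∈ coinvariants k I := by
  intro R _ _ g m hm
  rw [point_conjCoeff, point_conjCoeff]
  congr 1
  let g' := mapPoint (leftInclusion k R H) g
  let m' := mapPoint (leftInclusion k R H) m
  let n := rightPoint R q
  have hp : VanishesOn I (g' * m' * g'⁻¹) := hI _ g' m' (hm.mapPoint _)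
  have hn : VanishesOn I (g' * n * g'⁻¹) := hI _ g' n (hq.mapPoint _)
  have h : conjValue q c (g * m) =
      (g' * m' * g'⁻¹ * (g' * n * g'⁻¹) * (g' * m' * g'⁻¹)⁻¹) c := by
    have h' : mapPoint (leftInclusion k R H) (g * m) = g' * m' := map_mul _ _ _
    rw [conjValue, h']
    congr 2
    change g' * m' * n * (g' * m')⁻¹ = _
    group
  have h1 := hc.inv_apply_mul hε hp
  rw [h, hc.mul_apply _ hp.inv, hc.mul_apply _ hn]
  change _ = (g' * n * g'⁻¹) c
  linear_combination (g' * n * g'⁻¹) c * h1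

include hI hc in
omit [I.IsHopfIdeal k] in
-- Multiplicativity of n ↦ c(gng⁻¹) on N, read on coefficients: products correspond to convolution
-- of linear forms.
theorem conjCoeff_mul [Bialgebra k H] (f : X →ₐc[k] H)
    (hf : VanishesOn I (toConv (f : X →ₐ[k] H))) (φ ψ : Module.Dual k H) :
    conjCoeff (toConv (f : X →ₐ[k] H)) c φ * conjCoeff (toConv (f : X →ₐ[k] H)) c ψ =
      conjCoeff (toConv (f : X →ₐ[k] H)) c (LinearMap.mul' k k ∘ₗ TensorProduct.map φ ψ ∘ₗ Coalgebra.comul) := by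
  let g₁ : WithConv (X →ₐ[k] X ⊗[k] H) :=
    mapPoint (leftInclusion k X H) (toConv (AlgHom.id k X))
  -- On functions of (g, n), `i` gives the value at (g, n₁) and `θ` the value at (g, n₁n₂), for
  -- independent universal n₁ and n₂.
  let i : X ⊗[k] H →ₐ[k] (X ⊗[k] H) ⊗[k] H := leftInclusion k (X ⊗[k] H) H
  let θ : X ⊗[k] H →ₐ[k] (X ⊗[k] H) ⊗[k] H := (Algebra.TensorProduct.assoc k k k X H H).symm.toAlgHom.comp
    (Algebra.TensorProduct.map (.id k X) (Bialgebra.comulAlgHom k H))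
  let iP : WithConv (X →ₐ[k] X ⊗[k] H) →*
    WithConv (X →ₐ[k] (X ⊗[k] H) ⊗[k] H) := mapPoint i
  let θP : WithConv (X →ₐ[k] X ⊗[k] H) →*
    WithConv (X →ₐ[k] (X ⊗[k] H) ⊗[k] H) := mapPoint θ
  have hg : θP g₁ = iP g₁ := by
    apply WithConv.ext
    ext x
    change (Algebra.TensorProduct.assoc k k k X H H).symm
      (x ⊗ₜ Coalgebra.comul (R := k) (1 : H)) = (x ⊗ₜ 1) ⊗ₜ 1
    rw [Bialgebra.comul_one]
    rfl
  have hn : θP (rightPoint X (toConv (f : X →ₐ[k] H))) =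
      iP (rightPoint X (toConv (f : X →ₐ[k] H))) * rightPoint (X ⊗[k] H) (toConv (f : X →ₐ[k] H)) := by
    apply WithConv.ext
    ext x
    change _ = (iP (rightPoint X (toConv (f : X →ₐ[k] H))) * rightPoint (X ⊗[k] H) (toConv (f : X →ₐ[k] H))) x
    rw [point_mul_apply]
    change (Algebra.TensorProduct.assoc k k k X H H).symm (1 ⊗ₜ Coalgebra.comul (R := k) (f x)) = _
    rw [← CoalgHomClass.map_comp_comul_apply f x]
    generalize Coalgebra.comul (R := k) x = z
    induction z with
    | zero => simp
    | add a b ha hb => simp only [map_add, TensorProduct.tmul_add, ha, hb]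
    | tmul a b =>
      change ((1 : X) ⊗ₜ[k] f a) ⊗ₜ[k] f b =
        (((1 : X) ⊗ₜ[k] f a) ⊗ₜ[k] (1 : H)) *
          ((1 : X ⊗[k] H) ⊗ₜ[k] f b)
      simp
  have hslice : ∀ z : X ⊗[k] H, sliceRight X φ (sliceRight (X ⊗[k] H) ψ (θ z)) =
      sliceRight X (LinearMap.mul' k k ∘ₗ TensorProduct.map φ ψ ∘ₗ Coalgebra.comul) z := by
    intro z
    induction z with
    | zero => simp
    | add a b ha hb => simp only [map_add, ha, hb]
    | tmul x h =>
      rw [sliceRight_tmul]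
      change sliceRight X φ (sliceRight (X ⊗[k] H) ψ
        ((Algebra.TensorProduct.assoc k k k X H H).symm (x ⊗ₜ Coalgebra.comul (R := k) h))) =
        (LinearMap.mul' k k (TensorProduct.map φ ψ (Coalgebra.comul (R := k) h))) • x
      generalize Coalgebra.comul (R := k) h = w
      induction w with
      | zero => simp
      | add a b ha hb => simp only [map_add, TensorProduct.tmul_add, ha, hb, add_smul]
      | tmul a b =>
        change sliceRight X φ (sliceRight (X ⊗[k] H) ψ ((x ⊗ₜ a) ⊗ₜ b)) = _
        simp [mul_smul, smul_comm (ψ b) (φ a)]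
  have hθ : θ (conjValue (toConv (f : X →ₐ[k] H)) c (toConv (AlgHom.id k X))) =
      i (conjValue (toConv (f : X →ₐ[k] H)) c (toConv (AlgHom.id k X))) * conjValue (toConv (f : X →ₐ[k] H)) c g₁ := by
    let G := iP g₁
    let n₁ := iP (rightPoint X (toConv (f : X →ₐ[k] H)))
    let n₂ := rightPoint (X ⊗[k] H) (toConv (f : X →ₐ[k] H))
    have h1 : θ (conjValue (toConv (f : X →ₐ[k] H)) c (toConv (AlgHom.id k X))) =
        (G * (n₁ * n₂) * G⁻¹) c := by
      rw [← hn]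
      change _ = (iP g₁ * θP _ * (iP g₁)⁻¹) c
      rw [← hg]
      exact map_conj_apply θ _ _ c
    have h2 : i (conjValue (toConv (f : X →ₐ[k] H)) c (toConv (AlgHom.id k X))) =
        (G * n₁ * G⁻¹) c := map_conj_apply i _ _ c
    rw [h1, h2]
    exact hc.conj_mul hI G n₁ (hf.mapPoint _)
  have hψ : leftInclusion k X H (conjCoeff (toConv (f : X →ₐ[k] H)) c ψ) =
      sliceRight (X ⊗[k] H) ψ (conjValue (toConv (f : X →ₐ[k] H)) c g₁) := point_conjCoeff _ c ψ g₁
  conv_rhs => rw [conjCoeff, ← hslice, hθ, sliceRight_includeLeft_mul, ← hψ, mul_comm,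
    sliceRight_includeLeft_mul, mul_comm]
  rfl

include hε in
omit [I.IsHopfIdeal k] in
-- Contraction with the counit evaluates at q = 1, where the value is ε(c) = 1.
theorem conjCoeff_counit [Bialgebra k H] (f : X →ₐc[k] H) :
    conjCoeff (toConv (f : X →ₐ[k] H)) c Coalgebra.counit = 1 := by
  let r : H →ₐ[k] X := (Algebra.ofId k X).comp (Bialgebra.counitAlgHom k H)
  have h1 : ∀ z : X ⊗[k] H, sliceRight X Coalgebra.counit z =
      Algebra.TensorProduct.lift (.id k X) r (fun _ _ => .all _ _) z := by
    intro z
    induction z with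
    | zero => simp
    | add a b ha hb => simp only [map_add, ha, hb]
    | tmul x h =>
      rw [sliceRight_tmul, Algebra.TensorProduct.lift_tmul, Algebra.smul_def, mul_comm]
      rfl
  have h2 : mapPoint r (toConv (f : X →ₐ[k] H)) = 1 := by
    apply WithConv.ext
    ext x
    change algebraMap k X (Coalgebra.counit (f x)) = algebraMap k X (Coalgebra.counit x)
    rw [CoalgHomClass.counit_comp_apply]
  rw [conjCoeff, h1, lift_conjValue, h2, mul_one, mul_inv_cancel, point_one_apply, hε, map_one]

end

variable [I.IsHopfIdeal k] (hI : IsConjStable k I) (hc : IsSemiInvariant (k := k) I 1 c c)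
  (hε : Coalgebra.counit (R := k) c = 1)

include hI hc hε in
theorem exists_conj_eigenvector : ∃ s ∈ coinvariants k I, s ≠ 0 ∧
    ∀ φ : Module.Dual k (X ⧸ I), s * conjCoeff (quotientPoint k I) c φ = φ (Ideal.Quotient.mk I c) • s := by
  let f : X →ₐc[k] X ⧸ I := Bialgebra.Quotient.mkBialgHom I
  have hf : VanishesOn I (toConv (f : X →ₐ[k] X ⧸ I)) := vanishesOn_quotientPoint I
  let F : Module.Dual k (X ⧸ I) →ₗ[k] X :=
    { toFun := conjCoeff (quotientPoint k I) c
      map_add' := fun φ ψ => by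
        simp only [conjCoeff, sliceRight, LinearMap.lTensor_add, LinearMap.comp_add,
          LinearMap.add_apply]
      map_smul' := fun r φ => by
        simp only [conjCoeff, sliceRight, LinearMap.lTensor_smul, LinearMap.comp_smul,
          LinearMap.smul_apply, RingHom.id_apply] }
  -- All coefficients are slices of a single tensor, hence finite-dimensionality; on `B` the counit
  -- sends the coefficient of `φ` to φ(c mod I), by `counit_conjCoeff`.
  let B : Subalgebra k X :=
    { carrier := Set.range (conjCoeff (quotientPoint k I) c)
      mul_mem' := by
        rintro _ _ ⟨φ, rfl⟩ ⟨ψ, rfl⟩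
        exact ⟨_, (conjCoeff_mul hI hc f hf φ ψ).symm⟩
      add_mem' := by
        rintro _ _ ⟨φ, rfl⟩ ⟨ψ, rfl⟩
        exact ⟨φ + ψ, map_add F φ ψ⟩
      algebraMap_mem' := fun r => ⟨r • Coalgebra.counit, by
        rw [Algebra.algebraMap_eq_smul_one, ← conjCoeff_counit hε f]
        exact map_smul F r _⟩ }
  have hB : FiniteDimensional k B := by
    have h := finite_span_range_sliceRight (conjValue (quotientPoint k I) c (toConv (AlgHom.id k X)))
    have hle : Subalgebra.toSubmodule B ≤ Submodule.span k (Set.range fun φ => sliceRight X φ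
        (conjValue (quotientPoint k I) c (toConv (AlgHom.id k X)))) := Submodule.subset_span
    exact Submodule.finiteDimensional_of_le hle
  obtain ⟨s, hs, h⟩ := exists_ne_zero_forall_mul_eq_smul ((Bialgebra.counitAlgHom k X).comp B.val)
  refine ⟨s, ?_, fun h0 => hs (Subtype.ext h0), fun φ => ?_⟩
  · obtain ⟨φ, hφ⟩ := s.2
    rw [← hφ]
    exact conjCoeff_mem_coinvariants hI hc hε hf φ
  · rw [← quotientPoint_apply (k := k), ← counit_conjCoeff]
    exact congrArg Subtype.val (h ⟨_, φ, rfl⟩)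

include hI hc hε in
-- The antipode of a semi-invariant of weight c acquires the factor c(gng⁻¹)⁻¹ under g ↦ gn. The
-- factor `s` replaces c(gng⁻¹) by c(n), which gives weight c⁻¹.
theorem exists_isSemiInvariant_inverse :
    ∃ d, IsSemiInvariant (k := k) I c 1 d ∧ Coalgebra.counit (R := k) d = 1 := by
  obtain ⟨s, hsA, hs0, hs⟩ := exists_conj_eigenvector hI hc hε
  have hu : leftInclusion k X (X ⧸ I) s * conjValue (quotientPoint k I) c (toConv (AlgHom.id k X)) =
      s ⊗ₜ Ideal.Quotient.mk I c := by
    refine eq_of_sliceRight_eq fun φ => ?_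
    rw [sliceRight_includeLeft_mul, sliceRight_tmul]
    exact hs φ
  -- The identity `hu` evaluated at `g` in the first factor and at `n` in the second.
  have key : ∀ (R : Type u) [CommRing R] [Algebra k R] (g n : WithConv (X →ₐ[k] R)),
      VanishesOn I n → g s * (g * n * g⁻¹) c = g s * n c := by
    intro R _ _ g n hn
    have h := congrArg (Algebra.TensorProduct.map g.ofConv (.id k (X ⧸ I))) hu
    rw [map_mul, map_conjValue] at h
    have h2 := congrArg (Algebra.TensorProduct.lift (.id k R) hn.lift (fun _ _ => .all _ _)) h
    rw [map_mul] at h2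
    have h3 := lift_conjValue (quotientPoint k I) c
      (mapPoint g.ofConv (toConv (AlgHom.id k X))) hn.lift
    rw [hn.mapPoint_lift] at h3
    rw [h3] at h2
    change Algebra.TensorProduct.lift (.id k R) hn.lift (fun _ _ => .all _ _) (g s ⊗ₜ 1) *
      (g * n * g⁻¹) c = Algebra.TensorProduct.lift (.id k R) hn.lift (fun _ _ => .all _ _)
      (g s ⊗ₜ Ideal.Quotient.mk I c) at h2
    rw [Algebra.TensorProduct.lift_tmul, Algebra.TensorProduct.lift_tmul, map_one, mul_one] at h2
    exact h2
  have hd : ∀ b, IsSemiInvariant (k := k) I 1 c b →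
      IsSemiInvariant (k := k) I c 1 (s * HopfAlgebra.antipode k b) := by
    intro b hb R _ _ g n hn
    have hn' := hI R g n hn
    have h1 : (g * n)⁻¹ b = g⁻¹ b * (g * n * g⁻¹)⁻¹ c := by
      have h := hb R g⁻¹ (g * n * g⁻¹)⁻¹ hn'.inv
      rw [map_one, mul_one] at h
      rw [← h]
      congr 2
      group
    rw [map_mul, map_mul, map_one, mul_one, hsA R g n hn]
    change g s * (g * n)⁻¹ b * n c = g s * g⁻¹ b
    calc g s * (g * n)⁻¹ b * n c = (g * n)⁻¹ b * (g s * n c) := by ring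
      _ = (g * n)⁻¹ b * (g s * (g * n * g⁻¹) c) := by rw [key R g n hn]
      _ = g s * g⁻¹ b * ((g * n * g⁻¹)⁻¹ c * (g * n * g⁻¹) c) := by rw [h1]; ring
      _ = g s * g⁻¹ b := by rw [hc.inv_apply_mul hε hn', mul_one]
  -- If every translate gave zero, then s · c₁S(c₂) = s · ε(c) = s would vanish.
  obtain ⟨φ, hφ⟩ : ∃ φ : Module.Dual k X,
      s * HopfAlgebra.antipode k (sliceLeft X φ (Coalgebra.comul c)) ≠ 0 := by
    by_contra! h
    apply hs0
    have h1 : (LinearMap.mulLeft k s ∘ₗ HopfAlgebra.antipode k).lTensor X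
        (Coalgebra.comul (R := k) c) = 0 := by
      refine eq_of_sliceLeft_eq fun φ => ?_
      rw [sliceLeft_lTensor, map_zero]
      exact h φ
    have h2 : ∀ z : X ⊗[k] X, LinearMap.mul' k X
        ((LinearMap.mulLeft k s ∘ₗ HopfAlgebra.antipode k).lTensor X z) =
        s * LinearMap.mul' k X ((HopfAlgebra.antipode k).lTensor X z) := by
      intro z
      induction z with
      | zero => simp
      | add a b ha hb => simp only [map_add, mul_add, ha, hb]
      | tmul a b => simp [mul_left_comm]
    have h3 := h2 (Coalgebra.comul c)
    rw [h1, HopfAlgebra.mul_antipode_lTensor_comul_apply, hε, map_one, mul_one, map_zero] at h3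
    exact h3.symm
  obtain ⟨ψ, hψ⟩ : ∃ ψ : Module.Dual k X,
      ψ (s * HopfAlgebra.antipode k (sliceLeft X φ (Coalgebra.comul c))) = 1 :=
    Module.Projective.exists_dual_eq_one k hφ
  -- A further left translate keeps the weight and has counit ψ(·) = 1.
  exact ⟨_, (hd _ (hc.sliceLeft_comul φ)).sliceLeft_comul ψ, by rw [counit_sliceLeft_comul, hψ]⟩

end ConjugateCharacter

/-! ### Cramer's rule and adapted bases -/

theorem eq_zero_of_forall_det_updateRow_eq_zero {Q : Type*} [CommRing Q] {ι : Type*} [Fintype ι]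
    [DecidableEq ι] {P : Matrix ι ι Q} (hP : IsUnit P.det) {v : ι → Q}
    (h : ∀ m, (P.updateRow m v).det = 0) : v = 0 := by
  have h1 : Matrix.cramer P.transpose v = 0 := by
    ext m
    rw [Matrix.cramer_transpose_apply, h m, Pi.zero_apply]
  have h2 := Matrix.mulVec_cramer P.transpose v
  rw [h1, Matrix.mulVec_zero, Matrix.det_transpose] at h2
  exact (hP.smul_eq_zero).1 h2.symm

/-- A basis of V ∩ U is joined to one of a complement of V ∩ U in V; the complement injects into M ⧸
U. -/
theorem exists_adapted_basis {k M : Type u} [Field k] [AddCommGroup M] [Module k M]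
    (V U : Submodule k M) [FiniteDimensional k V] :
    ∃ (p q : ℕ) (b : Module.Basis (Fin p ⊕ Fin q) k V), (∀ i, (b (.inl i) : M) ∈ U) ∧
      (LinearIndependent k fun i => U.mkQ (b (.inr i))) ∧
      ∀ x ∈ V, x ∈ U → x ∈ Submodule.span k (Set.range fun i => (b (.inl i) : M)) := by
  obtain ⟨U', hU⟩ := (U.comap V.subtype).exists_isCompl
  let bU := Module.finBasis k (U.comap V.subtype)
  let bU' := Module.finBasis k U'
  let b := (bU.prod bU').map ((U.comap V.subtype).prodEquivOfIsCompl U' hU)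
  have hbl : ∀ i, b (.inl i) = bU i := fun i => by simp [b]
  have hbr : ∀ i, b (.inr i) = bU' i := fun i => by simp [b]
  refine ⟨_, _, b, fun i => ?_, ?_, fun x hxV hx => ?_⟩
  · rw [hbl]
    exact (bU i).2
  · have hf : LinearMap.ker (U.mkQ ∘ₗ V.subtype) = U.comap V.subtype := by
      rw [LinearMap.ker_comp, Submodule.ker_mkQ]
    have h := (bU'.linearIndependent.map' U'.subtype U'.ker_subtype).map
      (f := U.mkQ ∘ₗ V.subtype) (by
        rw [hf]
        refine hU.disjoint.symm.mono_left (Submodule.span_le.2 ?_)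
        rintro _ ⟨i, rfl⟩
        exact (bU' i).2)
    simp only [hbr]
    exact h
  · have h3 : ∑ i, bU.repr ⟨⟨x, hxV⟩, hx⟩ i • (b (.inl i) : M) = x := by
      have h2 := congrArg (fun u : U.comap V.subtype => ((u : V) : M)) (bU.sum_repr ⟨⟨x, hxV⟩, hx⟩)
      simp only [hbl]
      simpa only [Submodule.coe_sum, Submodule.coe_smul] using h2
    rw [← h3]
    exact Submodule.sum_mem _ fun i _ => Submodule.smul_mem _ _ (Submodule.subset_span ⟨i, rfl⟩)

/-! ### Finite-dimensional coideals and their coefficients -/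

section Subcomodule

variable {k : Type u} [Field k] {X : Type u} [CommRing X] [HopfAlgebra k X]

theorem comul_sliceRight_comul (φ : Module.Dual k X) (x : X) :
    Coalgebra.comul (R := k) (sliceRight X φ (Coalgebra.comul x)) =
      (sliceRight X φ ∘ₗ Coalgebra.comul).lTensor X (Coalgebra.comul (R := k) x) := by
  have h1 : ∀ z : X ⊗[k] (X ⊗[k] X), sliceRight (X ⊗[k] X) φ
      ((TensorProduct.assoc k X X X).symm z) = (sliceRight X φ).lTensor X z := by
    intro z
    induction z with
    | zero => simp
    | add a b ha hb => simp only [map_add, ha, hb]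
    | tmul a z =>
      induction z with
      | zero => simp
      | add b c hb hc => simp only [map_add, TensorProduct.tmul_add, hb, hc]
      | tmul b c => simp
  rw [← sliceRight_rTensor, ← Coalgebra.coassoc_symm_apply, h1, LinearMap.lTensor_comp_apply]

theorem sliceRight_lTensor {M V W : Type u} [AddCommGroup M] [Module k M] [AddCommGroup V]
    [Module k V] [AddCommGroup W] [Module k W] (φ : Module.Dual k W) (f : V →ₗ[k] W)
    (z : M ⊗[k] V) : sliceRight M φ (f.lTensor M z) = sliceRight M (φ ∘ₗ f) z := by
  induction z with
  | zero => simp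
  | add a b ha hb => simp only [map_add, ha, hb]
  | tmul a b => simp

theorem sliceRight_counit_comul (x : X) :
    sliceRight X Coalgebra.counit (Coalgebra.comul (R := k) x) = x := by
  rw [sliceRight, LinearMap.comp_apply, Coalgebra.lTensor_counit_comul]
  simp

theorem sliceLeft_map {H : Type u} [CommRing H] [Algebra k H] (q : X →ₐ[k] H)
    (φ : Module.Dual k H) (z : X ⊗[k] X) :
    sliceLeft H φ (Algebra.TensorProduct.map q q z) =
      q (sliceLeft X (φ ∘ₗ q.toLinearMap) z) := by
  induction z with
  | zero => simp
  | add a b ha hb => simp only [map_add, ha, hb]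
  | tmul a b => simp

/-- Every element of a coalgebra lies in a finite-dimensional right coideal. -/
theorem exists_finiteDimensional_coideal (x : X) : ∃ V : Submodule k X, FiniteDimensional k V ∧
    x ∈ V ∧ ∀ v ∈ V, ∀ φ : Module.Dual k X, sliceRight X φ (Coalgebra.comul v) ∈ V := by
  -- The slices of Δ(x) contain x, by the counit axiom, and are stable under slicing, by
  -- coassociativity.
  refine ⟨Submodule.span k (Set.range fun φ => sliceRight X φ (Coalgebra.comul x)),
    finite_span_range_sliceRight _, Submodule.subset_span ⟨_, sliceRight_counit_comul x⟩, ?_⟩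
  intro v hv ψ
  refine Submodule.span_induction (p := fun v _ => sliceRight X ψ (Coalgebra.comul v) ∈ _)
    ?_ ?_ ?_ ?_ hv
  · rintro _ ⟨φ, rfl⟩
    rw [comul_sliceRight_comul, sliceRight_lTensor]
    exact Submodule.subset_span ⟨_, rfl⟩
  · simp
  · intro a b _ _ ha hb
    rw [map_add, map_add]
    exact add_mem ha hb
  · intro r a _ ha
    rw [map_smul, map_smul]
    exact Submodule.smul_mem _ _ ha

theorem exists_eq_sum_tmul {V : Submodule k X} {ι : Type} [Fintype ι] [DecidableEq ι]
    (b : Module.Basis ι k V) {z : X ⊗[k] X} (hz : ∀ φ, sliceRight X φ z ∈ V) :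
    ∃ a : ι → X, z = ∑ i, (b i : X) ⊗ₜ a i := by
  obtain ⟨y, rfl⟩ := mem_range_rTensor_subtype V hz
  clear hz
  induction y with
  | zero => exact ⟨0, by simp⟩
  | add y z hy hz =>
    obtain ⟨a, ha⟩ := hy
    obtain ⟨a', ha'⟩ := hz
    exact ⟨a + a', by simp [ha, ha', TensorProduct.tmul_add, Finset.sum_add_distrib]⟩
  | tmul v x =>
    refine ⟨fun i => b.repr v i • x, ?_⟩
    rw [LinearMap.rTensor_tmul]
    conv_lhs => rw [← b.sum_repr v, map_sum, TensorProduct.sum_tmul]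
    refine Finset.sum_congr rfl fun i _ => ?_
    rw [map_smul, TensorProduct.smul_tmul]
    rfl

/-- The data of a finite-dimensional right coideal, with a basis adapted to `I`, and of its
matrix of coefficients. -/
structure IsAdaptedCoefficientMatrix (I : Ideal X) {ι κ : Type} [Fintype ι] [Fintype κ]
    (e : ι ⊕ κ → X) (a : Matrix (ι ⊕ κ) (ι ⊕ κ) X) : Prop where
  comul_eq : ∀ j, Coalgebra.comul (R := k) (e j) = ∑ i, e i ⊗ₜ a i j
  linearIndependent : LinearIndependent k e
  inl_mem : ∀ i, e (.inl i) ∈ I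
  linearIndependent_mk : LinearIndependent k fun i => Ideal.Quotient.mk I (e (.inr i))

theorem exists_isAdaptedCoefficientMatrix {I : Ideal X} {x : X} (hx : x ∈ I) :
    ∃ (p q : ℕ) (e : Fin p ⊕ Fin q → X) (a : Matrix (Fin p ⊕ Fin q) (Fin p ⊕ Fin q) X),
      IsAdaptedCoefficientMatrix (k := k) I e a ∧
        x ∈ Submodule.span k (Set.range fun i => e (.inl i)) := by
  obtain ⟨V, hV, hxV, hVs⟩ := exists_finiteDimensional_coideal (k := k) x
  obtain ⟨p, q, b, hbl, hbr, hbs⟩ := exists_adapted_basis V (I.restrictScalars k)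
  have hb : ∀ j, ∃ a : _ → X, Coalgebra.comul (R := k) (b j : X) = ∑ i, (b i : X) ⊗ₜ a i :=
    fun j => exists_eq_sum_tmul b (hVs _ (b j).2)
  choose a ha using hb
  exact ⟨p, q, fun i => (b i : X), fun i j => a j i,
    ⟨ha, b.linearIndependent.map' V.subtype V.ker_subtype, hbl, hbr⟩, hbs x hxV hx⟩

end Subcomodule

/-! ### Minors of the coefficient matrix -/

namespace IsAdaptedCoefficientMatrix

variable {k : Type u} [Field k] {X : Type u} [CommRing X] [HopfAlgebra k X] {I : Ideal X}
  {ι κ : Type} [Fintype ι] [Fintype κ] [DecidableEq ι] [DecidableEq κ]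
  {e : ι ⊕ κ → X} {a : Matrix (ι ⊕ κ) (ι ⊕ κ) X}
  (h : IsAdaptedCoefficientMatrix (k := k) I e a)

include h

theorem comul_apply (i j : ι ⊕ κ) :
    Coalgebra.comul (R := k) (a i j) = ∑ l, a i l ⊗ₜ a l j := by
  obtain ⟨φ, hφ⟩ := exists_dual_family h.linearIndependent
  have h1 := Coalgebra.coassoc_apply (R := k) (e j)
  simp only [h.comul_eq, map_sum, LinearMap.rTensor_tmul, LinearMap.lTensor_tmul,
    TensorProduct.sum_tmul, TensorProduct.assoc_tmul] at h1
  have h2 := congrArg (sliceLeft (X ⊗[k] X) (φ i)) h1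
  simp only [map_sum, sliceLeft_tmul, hφ, ite_smul, one_smul, zero_smul, Finset.sum_ite_eq,
    Finset.mem_univ, if_true] at h2
  exact h2.symm

theorem counit_apply (i j : ι ⊕ κ) :
    Coalgebra.counit (R := k) (a i j) = if i = j then 1 else 0 := by
  obtain ⟨φ, hφ⟩ := exists_dual_family h.linearIndependent
  have h1 := sliceRight_counit_comul (k := k) (e j)
  have h2 := congrArg (φ i) h1
  simpa only [h.comul_eq, map_sum, sliceRight_tmul, map_smul, hφ, smul_eq_mul, mul_ite, mul_one,
    mul_zero, Finset.sum_ite_eq, Finset.mem_univ, if_true] using h2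

omit [DecidableEq ι] [DecidableEq κ] in
theorem eq_sum_counit_smul (j : ι ⊕ κ) :
    e j = ∑ i, Coalgebra.counit (R := k) (e i) • a i j := by
  have h1 := Coalgebra.rTensor_counit_comul (R := k) (e j)
  have h2 := congrArg (TensorProduct.lid k X) h1
  simpa only [h.comul_eq, map_sum, LinearMap.rTensor_tmul, TensorProduct.lid_tmul, one_smul]
    using h2.symm

omit [DecidableEq ι] in
-- N preserves V ∩ I: Δ(e_j) dies in (X ⧸ I) ⊗ (X ⧸ I), and a form dual to the independent classes
-- of the e_inr extracts the entry.
theorem mem_of_inr_inl [I.IsHopfIdeal k] (i : κ) (j : ι) : a (.inr i) (.inl j) ∈ I := by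
  obtain ⟨φ, hφ⟩ := exists_dual_family h.linearIndependent_mk
  have h1 : Algebra.TensorProduct.map (Ideal.Quotient.mkₐ k I) (Ideal.Quotient.mkₐ k I)
      (Coalgebra.comul (R := k) (e (.inl j))) = 0 :=
    Submodule.IsCoideal.map_mkQ_comul_eq_zero (R := k) (I := I.restrictScalars k) (h.inl_mem j)
  have h2 : ∀ l, φ i (Ideal.Quotient.mk I (e (.inl l))) = 0 := fun l => by
    rw [Ideal.Quotient.eq_zero_iff_mem.2 (h.inl_mem l), map_zero]
  have h3 := sliceLeft_map (Ideal.Quotient.mkₐ k I) (φ i) (Coalgebra.comul (R := k) (e (.inl j)))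
  rw [h1, map_zero, h.comul_eq, map_sum, Fintype.sum_sum_type] at h3
  simp only [sliceLeft_tmul, LinearMap.comp_apply, AlgHom.toLinearMap_apply,
    Ideal.Quotient.mkₐ_eq_mk, h2, hφ, ite_smul, one_smul, zero_smul, Finset.sum_const_zero,
    zero_add, Finset.sum_ite_eq, Finset.mem_univ, if_true] at h3
  exact Ideal.Quotient.eq_zero_iff_mem.1 h3.symm

theorem point_mul_apply {R : Type u} [CommRing R] [Algebra k R] (g n : WithConv (X →ₐ[k] R))
    (i j : ι ⊕ κ) : (g * n) (a i j) = ∑ l, g (a i l) * n (a l j) := by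
  rw [CommHopf.point_mul_apply, h.comul_apply, map_sum]
  rfl

/-- By block triangularity on N, the `inl` columns at gn are those at g times the diagonal block at
n. The weight is therefore the same for every choice of rows `ρ`. -/
theorem isSemiInvariant_minor [I.IsHopfIdeal k] (ρ : ι → ι ⊕ κ) :
    IsSemiInvariant (k := k) I 1 (a.submatrix .inl .inl).det (a.submatrix ρ .inl).det := by
  intro R _ _ g n hn
  rw [map_one, mul_one, AlgHom.map_det, AlgHom.map_det, AlgHom.map_det, ← Matrix.det_mul]
  congr 1
  ext i j
  change (g * n) (a (ρ i) (.inl j)) = ∑ l, g (a (ρ i) (.inl l)) * n (a (.inl l) (.inl j))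
  rw [h.point_mul_apply, Fintype.sum_sum_type]
  simp [hn _ (h.mem_of_inr_inl _ j)]

theorem counit_minor_inl :
    Coalgebra.counit (R := k) (a.submatrix .inl .inl : Matrix ι ι X).det = 1 := by
  change Bialgebra.counitAlgHom k X _ = 1
  rw [AlgHom.map_det, ← Matrix.det_one (n := ι)]
  congr 1
  ext i j
  refine (h.counit_apply (.inl i) (.inl j)).trans ?_
  simp [Matrix.one_apply]

theorem counit_minor_update (m : ι) (i : κ) : Coalgebra.counit (R := k)
    (a.submatrix (Function.update .inl m (.inr i)) .inl : Matrix ι ι X).det = 0 := by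
  change Bialgebra.counitAlgHom k X _ = 0
  rw [AlgHom.map_det]
  refine Matrix.det_eq_zero_of_row_eq_zero m fun j => ?_
  refine (h.counit_apply _ (.inl j)).trans ?_
  simp

/-- Modulo `J` elements of A equal their counits, so every minor times `d` is known: 1 for the
diagonal block, 0 once a row is replaced by a lower one. -/
theorem mem_map_augmentationIdeal [I.IsHopfIdeal k] (hI : IsConjStable k I) (j : ι) :
    e (.inl j) ∈ Ideal.map (coinvariants k I).val (augmentationIdeal (coinvariants k I)) := by
  set J := Ideal.map (coinvariants k I).val (augmentationIdeal (coinvariants k I)) with hJ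
  let c : X := (a.submatrix .inl .inl : Matrix ι ι X).det
  obtain ⟨d, hd, hd1⟩ := exists_isSemiInvariant_inverse hI (h.isSemiInvariant_minor .inl)
    h.counit_minor_inl
  have hinv : ∀ ρ : ι → ι ⊕ κ, (a.submatrix ρ .inl).det * d ∈ coinvariants k I := by
    intro ρ R _ _ g n hn
    have h1 := h.isSemiInvariant_minor ρ R g n hn
    have h2 := hd R g n hn
    rw [map_one, mul_one] at h1 h2
    rw [map_mul, map_mul, h1, ← h2]
    ring
  have hmem : ∀ y ∈ coinvariants k I,
      Ideal.Quotient.mk J y = algebraMap k _ (Coalgebra.counit y) := by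
    intro y hy
    rw [← sub_eq_zero]
    have h1 : y - algebraMap k X (Coalgebra.counit y) ∈ J := by
      refine Ideal.mem_map_of_mem (coinvariants k I).val
        (x := (⟨y, hy⟩ : coinvariants k I) - algebraMap k _ (Coalgebra.counit y)) ?_
      change Bialgebra.counitAlgHom k X (y - algebraMap k X (Coalgebra.counit y)) = 0
      simp
    exact Ideal.Quotient.eq_zero_iff_mem.2 h1
  have hunit : Ideal.Quotient.mk J c * Ideal.Quotient.mk J d = 1 := by
    rw [← map_mul, hmem _ (hinv .inl), Bialgebra.counit_mul, h.counit_minor_inl, hd1, mul_one,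
      map_one]
  have hzero : ∀ m i, Ideal.Quotient.mk J
      (a.submatrix (Function.update .inl m (.inr i)) .inl : Matrix ι ι X).det = 0 := by
    intro m i
    have h1 := hmem _ (hinv (Function.update .inl m (.inr i)))
    rw [Bialgebra.counit_mul, h.counit_minor_update, zero_mul, map_zero, map_mul] at h1
    have h2 := congrArg (· * Ideal.Quotient.mk J c) h1
    simp only [zero_mul] at h2
    rwa [mul_assoc, mul_comm (Ideal.Quotient.mk J d), hunit, mul_one] at h2
  -- Modulo `J` the diagonal block is invertible and every replacement of one of its rows by the
  -- lower row `i` has determinant zero, so that row vanishes.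
  have hrow : ∀ i, (fun l => Ideal.Quotient.mk J (a (.inr i) (.inl l))) = 0 := by
    intro i
    refine eq_zero_of_forall_det_updateRow_eq_zero
      (P := (a.submatrix .inl .inl : Matrix ι ι X).map (Ideal.Quotient.mk J)) ?_ fun m => ?_
    · have h1 := RingHom.map_det (Ideal.Quotient.mk J) (a.submatrix .inl .inl : Matrix ι ι X)
      refine IsUnit.of_mul_eq_one (Ideal.Quotient.mk J d) ?_
      rw [← hunit]
      exact congrArg (· * _) h1.symm
    · rw [← hzero m i, RingHom.map_det]
      congr 1
      ext l j
      by_cases hl : l = m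
      · subst hl
        simp
      · simp [hl]
  -- In e_j = ∑ ε(e_i) a_ij the upper terms vanish because ε(I) = 0, and the lower ones lie in `J`
  -- by `hrow`.
  rw [h.eq_sum_counit_smul, Fintype.sum_sum_type]
  refine add_mem (Submodule.sum_mem _ fun i _ => ?_) (Submodule.sum_mem _ fun i _ => ?_)
  · have h0 : Coalgebra.counit (R := k) (e (.inl i)) = 0 :=
      Submodule.IsCoideal.counit_eq_zero (R := k) (I := I.restrictScalars k) (h.inl_mem i)
    rw [h0, zero_smul]
    exact zero_mem _
  · rw [Algebra.smul_def]
    exact Ideal.mul_mem_left _ _ (Ideal.Quotient.eq_zero_iff_mem.1 (congrFun (hrow i) j))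

end IsAdaptedCoefficientMatrix

theorem eq_map_augmentationIdeal_coinvariants {k : Type u} [Field k] {X : Type u} [CommRing X]
    [HopfAlgebra k X] {I : Ideal X} [I.IsHopfIdeal k] (hI : IsConjStable k I) :
    I = Ideal.map (coinvariants k I).val (augmentationIdeal (coinvariants k I)) := by
  refine le_antisymm (fun x hx => ?_) map_augmentationIdeal_coinvariants_le
  obtain ⟨p, q, e, a, h, hxe⟩ := exists_isAdaptedCoefficientMatrix (k := k) hx
  have hle : Submodule.span k (Set.range fun i => e (.inl i)) ≤
      (Ideal.map (coinvariants k I).val (augmentationIdeal (coinvariants k I))).restrictScalars k :=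
    Submodule.span_le.2 (Set.range_subset_iff.2 (h.mem_map_augmentationIdeal hI))
  exact hle hxe

end CommHopf

theorem theorem3p4 {k : Type u} [Field k] {X : Type u} [CommRing X] [HopfAlgebra k X]
    (I : Ideal X) (hI : CommHopf.IsHopfIdeal k I) :
    List.TFAE
      [CommHopf.IsNormalHopfIdeal k I,
       ∃ A : Subalgebra k X, CommHopf.IsHopfSubalgebra A ∧
         I = Ideal.map A.val (CommHopf.augmentationIdeal A),
       ∀ x ∈ I, CommHopf.coadjoint k X x ∈ CommHopf.tensorIdeal k I] := by
  tfae_have 1 → 2 := fun h => by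
    obtain ⟨W, g, rfl⟩ := h.exists_eq_mapAugmentation
    exact ⟨_, CommHopf.isHopfSubalgebra_range g, CommHopf.mapAugmentation_eq_map_range g⟩
  tfae_have 2 → 1 := by
    rintro ⟨A, hA, rfl⟩
    let _ := hA.hopfAlgebra
    exact CommHopf.isNormalHopfIdeal_mapAugmentation hA.valBialgHom
  tfae_have 2 → 3 := by
    rintro ⟨A, hA, rfl⟩
    let _ := hA.hopfAlgebra
    exact CommHopf.coadjoint_mem_iff_isConjStable.2
      (CommHopf.isConjStable_mapAugmentation hA.valBialgHom)
  tfae_have 3 → 2 := fun h => by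
    have := hI.ideal_isHopfIdeal
    have hI' := CommHopf.coadjoint_mem_iff_isConjStable.1 h
    exact ⟨_, CommHopf.isHopfSubalgebra_coinvariants hI',
      CommHopf.eq_map_augmentationIdeal_coinvariants hI'⟩
  tfae_finish
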